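/- Let $K/k$ be a finite Galois extension of fields with group $G=\mathrm{Gal}(K/k)$. Let $\mathcal U$ be a $G$-integer, i.e. the additive group $\mathbb Z$ with an action of $G$ by group automorphisms, and let $I=\{g\in G : g\cdot 1=1 \text{ in } \mathcal U\}$ be its canonical subgroup, with fixed field $L=K^I$. Let $G$ act on $\mathcal U\otimes_{\mathbb Z}K^\times$ by $g\cdot(m\otimes x)=(g\cdot m)\otimes g(x)$. Let $\mathrm{Br}(k|L)$ be the group (under $\otimes_k$) of similarity classes of finite-dimensional central simple $k$-algebras that split over $L$. Then there is an isomorphism of groups $$\Phi: H^1(G,\mathcal U\otimes_{\mathbb Z}K^\times)\;\xrightarrow{\ \sim\ }\;\mathrm{Br}(k|L).$$ It can be described explicitly. For $a\in k^\times$, the map $c(a):G\to\mathcal U\otimes K^\times$ with $c(a)_g=1\otimes a$ for $g\notin I$ and $c(a)_g$ the neutral element for $g\in I$ is a 1-cocycle, and $\Phi$ can be chosen so that: 1. every class in $H^1(G,\mathcal U\otimes K^\times)$ is the class of $c(a)$ for some $a\in k^\times$; 2. for $a,b\in k^\times$, $c(a)$ and $c(b)$ are cohomologous if and only if $a=b\,N_{L/k}(t)$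 for some $t\in L$; 3. for every $a\in k^\times$ and every generator $\sigma$ of $\mathrm{Gal}(L/k)$ (a group of order at most $2$), $\Phi$ sends the class of $c(a)$ to the class of the cyclic algebra $(L/k,\sigma,a)$, i.e. of a central simple $k$-algebra of dimension $[L:k]^2$ that contains $L$ and an element $u$ with $u^{[L:k]}=a$ and $ux=\sigma(x)u$ for all $x\in L$. -/

import Mathlib

open scoped TensorProduct
universe u v w

/-! ### Tensor products of central simple algebras -/

section CentralSimple
variable (k : Type u) [Field k] (A : Type v) [Ring A] [Algebra k A]

theorem mulLeftRight_surjective_of_central_simple [Algebra.IsCentral k A] [IsSimpleRing A]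
    [FiniteDimensional k A] : Function.Surjective (AlgHom.mulLeftRight k A) := by
  let _ : Module (A ⊗[k] Aᵐᵒᵖ) A := TensorProduct.Algebra.module
  have hsmul : ∀ (r : A ⊗[k] Aᵐᵒᵖ) (x : A), r • x = AlgHom.mulLeftRight k A r x := fun _ _ => rfl
  have hs : ∀ (a b x : A), (a ⊗ₜ[k] MulOpposite.op b : A ⊗[k] Aᵐᵒᵖ) • x = a * x * b := by
    intro a b x; rw [hsmul]; simp
  have : IsSimpleModule (A ⊗[k] Aᵐᵒᵖ) A := by
    rw [isSimpleModule_iff]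
    refine { exists_pair_ne := ⟨⊥, ⊤, fun h => ?_⟩, eq_bot_or_eq_top := fun N => ?_ }
    · have h1 : (1 : A) ∈ (⊥ : Submodule (A ⊗[k] Aᵐᵒᵖ) A) := h ▸ Submodule.mem_top
      exact one_ne_zero ((Submodule.mem_bot _).1 h1)
    · have hl : ∀ {x y : A}, y ∈ N → x * y ∈ N := fun {x y} hy => by
        have := N.smul_mem (x ⊗ₜ[k] MulOpposite.op 1) hy
        rwa [hs, mul_one] at this
      have hr : ∀ {x y : A}, x ∈ N → x * y ∈ N := fun {x y} hy => by
        have := N.smul_mem (1 ⊗ₜ[k] MulOpposite.op y) hy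
        rwa [hs, one_mul] at this
      let J : TwoSidedIdeal A := TwoSidedIdeal.mk' N N.zero_mem N.add_mem N.neg_mem hl hr
      have hJ : ∀ x, x ∈ J ↔ x ∈ N := fun x => TwoSidedIdeal.mem_mk' _ _ _ _ _ _ _
      rcases eq_bot_or_eq_top J with h | h
      · left
        rw [eq_bot_iff]
        intro x hx
        rw [Submodule.mem_bot]
        exact (TwoSidedIdeal.mem_bot A).1 (h ▸ (hJ x).2 hx)
      · right
        rw [eq_top_iff]
        intro x _
        exact (hJ x).1 (h ▸ TwoSidedIdeal.mem_top A)
  intro f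
  have hcomm : ∀ (φ : Module.End (A ⊗[k] Aᵐᵒᵖ) A) (x : A), f (φ x) = φ (f x) := by
    intro φ
    have h1 : ∀ x, φ x = x * φ 1 := fun x => by
      have := φ.map_smul (x ⊗ₜ[k] MulOpposite.op 1) 1
      rwa [hs, hs, mul_one, mul_one, mul_one] at this
    have h2 : ∀ x, φ x = φ 1 * x := fun x => by
      have := φ.map_smul (1 ⊗ₜ[k] MulOpposite.op x) 1
      rwa [hs, hs, one_mul, one_mul, one_mul] at this
    have hc : φ 1 ∈ Subalgebra.center k A :=
      Subalgebra.mem_center_iff.2 fun b => by rw [← h1, h2]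
    obtain ⟨c, hc⟩ := Algebra.IsCentral.mem_center_iff k |>.1 hc
    have h3 : ∀ x, φ x = c • x := fun x => by rw [h2, hc, Algebra.smul_def]
    intro x
    rw [h3, h3, map_smul]
  let F : Module.End (Module.End (A ⊗[k] Aᵐᵒᵖ) A) A :=
    { toFun := f, map_add' := f.map_add, map_smul' := fun φ x => hcomm φ x }
  classical
  obtain ⟨r, hr⟩ := jacobson_density F (Finset.univ.image (Module.finBasis k A))
  refine ⟨r, (Module.finBasis k A).ext fun i => ?_⟩
  exact (hr _ (Finset.mem_image_of_mem _ (Finset.mem_univ i))).symm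

theorem mulLeftRight_bijective_of_central_simple [Algebra.IsCentral k A] [IsSimpleRing A]
    [FiniteDimensional k A] : Function.Bijective (AlgHom.mulLeftRight k A) := by
  have hs := mulLeftRight_surjective_of_central_simple k A
  refine ⟨?_, hs⟩
  have : Module.finrank k (A ⊗[k] Aᵐᵒᵖ) = Module.finrank k (Module.End k A) := by
    rw [Module.finrank_tensorProduct, Module.finrank_linearMap,
      (MulOpposite.opLinearEquiv k : A ≃ₗ[k] Aᵐᵒᵖ).finrank_eq]
  exact (LinearMap.injective_iff_surjective_of_finrank_eq_finrank
    (f := (AlgHom.mulLeftRight k A).toLinearMap) this).2 hs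

variable (B : Type w) [Ring B] [Algebra k B]

theorem isSimpleRing_tensorProduct [Algebra.IsCentral k A] [IsSimpleRing A]
    [FiniteDimensional k A] [IsSimpleRing B] : IsSimpleRing (A ⊗[k] B) := by
  refine .of_eq_bot_or_eq_top fun I => ?_
  by_cases hI : ∀ w ∈ I, w = 0
  · left
    exact le_antisymm (fun w hw => (TwoSidedIdeal.mem_bot _).2 (hI w hw)) bot_le
  right
  push Not at hI
  obtain ⟨w, hw, hw0⟩ := hI
  -- slicing by a linear functional can be done by multiplications in `A`
  have slice : ∀ φ : A →ₗ[k] k,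
      (1 : A) ⊗ₜ[k] (TensorProduct.lid k B (TensorProduct.map φ LinearMap.id w)) ∈ I := by
    intro φ
    obtain ⟨r, hr⟩ := mulLeftRight_surjective_of_central_simple k A
      ((Algebra.linearMap k A).comp φ)
    have key : ∀ r : A ⊗[k] Aᵐᵒᵖ, LinearMap.rTensor B (AlgHom.mulLeftRight k A r) w ∈ I := by
      intro r
      induction r using TensorProduct.induction_on with
      | zero => simp [I.zero_mem]
      | add r s hr hs =>
        rw [map_add, LinearMap.rTensor_add, LinearMap.add_apply]
        exact I.add_mem hr hs
      | tmul a b =>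
        have h : ∀ w : A ⊗[k] B, LinearMap.rTensor B (AlgHom.mulLeftRight k A (a ⊗ₜ b)) w =
            (a ⊗ₜ[k] (1 : B)) * w * (b.unop ⊗ₜ[k] (1 : B)) := by
          intro w
          induction w using TensorProduct.induction_on with
          | zero => simp
          | add x y hx hy => rw [map_add, hx, hy, mul_add, add_mul]
          | tmul x y => simp
        rw [h]
        exact I.mul_mem_right _ _ (I.mul_mem_left _ _ hw)
    have h2 : ∀ w : A ⊗[k] B, LinearMap.rTensor B ((Algebra.linearMap k A).comp φ) w =
        (1 : A) ⊗ₜ[k] (TensorProduct.lid k B (TensorProduct.map φ LinearMap.id w)) := by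
      intro w
      induction w using TensorProduct.induction_on with
      | zero => simp
      | add x y hx hy => rw [map_add, hx, hy, map_add, map_add, TensorProduct.tmul_add]
      | tmul x y => simp [Algebra.algebraMap_eq_smul_one, TensorProduct.smul_tmul]
    rw [← h2, ← hr]
    exact key r
  obtain ⟨φ, hφ⟩ : ∃ φ : A →ₗ[k] k,
      TensorProduct.lid k B (TensorProduct.map φ LinearMap.id w) ≠ 0 := by
    by_contra! h
    apply hw0
    let b := Module.finBasis k A
    have hz : TensorProduct.equivFinsuppOfBasisLeft b w = 0 := by
      ext i
      have := h (b.coord i)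
      rw [TensorProduct.equivFinsuppOfBasisLeft_apply]
      exact this
    simpa using hz
  rw [← TwoSidedIdeal.one_mem_iff]
  let J : TwoSidedIdeal B := I.comap (Algebra.TensorProduct.includeRight : B →ₐ[k] A ⊗[k] B)
  have hJ : (1 : B) ∈ J :=
    IsSimpleRing.one_mem_of_ne_zero_mem J hφ ((TwoSidedIdeal.mem_comap _).2 (slice φ))
  have h1 := (TwoSidedIdeal.mem_comap _).1 hJ
  rwa [map_one] at h1

theorem isCentral_tensorProduct [Nontrivial A] [Algebra.IsCentral k A] [Algebra.IsCentral k B] :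
    Algebra.IsCentral k (A ⊗[k] B) := by
  refine ⟨fun z hz => ?_⟩
  have h1 : z ∈ Subalgebra.centralizer k
      ((Algebra.TensorProduct.includeLeft : A →ₐ[k] A ⊗[k] B).range : Set (A ⊗[k] B)) :=
    Subalgebra.mem_centralizer_iff k |>.2 fun x _ => Subalgebra.mem_center_iff.1 hz x
  rw [Subalgebra.centralizer_coe_range_includeLeft_eq_center_tensorProduct] at h1
  have h2 : ∀ y, ∃ b : B, Algebra.TensorProduct.map (Subalgebra.center k A).val (AlgHom.id k B) y
      = (1 : A) ⊗ₜ[k] b := by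
    intro y
    induction y using TensorProduct.induction_on with
    | zero => exact ⟨0, by simp⟩
    | add x y hx hy =>
      obtain ⟨b, hb⟩ := hx
      obtain ⟨c, hc⟩ := hy
      exact ⟨b + c, by rw [map_add, hb, hc, TensorProduct.tmul_add]⟩
    | tmul a b =>
      obtain ⟨c, hc⟩ := (Algebra.IsCentral.mem_center_iff k).1 a.2
      exact ⟨c • b, by simp [hc, Algebra.algebraMap_eq_smul_one, TensorProduct.smul_tmul]⟩
  obtain ⟨y, rfl⟩ := h1
  obtain ⟨b, hb⟩ := h2 y
  change Algebra.TensorProduct.map (Subalgebra.center k A).val (AlgHom.id k B) y ∈ _ at hz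
  change Algebra.TensorProduct.map (Subalgebra.center k A).val (AlgHom.id k B) y ∈ _
  rw [hb] at hz ⊢
  have hbc : b ∈ Subalgebra.center k B := by
    refine Subalgebra.mem_center_iff.2 fun c => ?_
    have := Subalgebra.mem_center_iff.1 hz ((1 : A) ⊗ₜ[k] c)
    rw [Algebra.TensorProduct.tmul_mul_tmul, Algebra.TensorProduct.tmul_mul_tmul, one_mul] at this
    exact Algebra.TensorProduct.includeRight_injective (R := k) (A := A) (B := B)
      (FaithfulSMul.algebraMap_injective k A) this
  obtain ⟨c, rfl⟩ := (Algebra.IsCentral.mem_center_iff k).1 hbc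
  exact Algebra.mem_bot.2 ⟨c, by
    rw [Algebra.TensorProduct.algebraMap_apply, Algebra.algebraMap_eq_smul_one,
      Algebra.algebraMap_eq_smul_one, TensorProduct.smul_tmul]⟩

end CentralSimple

/-! ### The Brauer group and the relative Brauer group -/

section Brauer

/-- The `1 × 1` matrices over `A` are `A`. -/
def matrixFinOneEquiv (R : Type u) (A : Type v) [CommSemiring R] [Semiring A] [Algebra R A] :
    Matrix (Fin 1) (Fin 1) A ≃ₐ[R] A where
  toFun M := M 0 0
  invFun a := Matrix.of fun _ _ => a
  left_inv M := by
    ext i j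
    rw [Subsingleton.elim i 0, Subsingleton.elim j 0]
    rfl
  right_inv _ := rfl
  map_add' _ _ := rfl
  map_mul' _ _ := by simp [Matrix.mul_apply]
  commutes' _ := by simp [Matrix.algebraMap_matrix_apply]

variable {k : Type u} [Field k]

/-- A finite-dimensional central simple algebra as a member of `CSA`. -/
abbrev CSA.ofAlgebra (k : Type u) [Field k] (A : Type u) [Ring A] [Algebra k A] [Algebra.IsCentral k A]
    [IsSimpleRing A] [FiniteDimensional k A] : CSA.{u, u} k :=
  { AlgCat.of k A with }

/-- The tensor product of two central simple algebras. -/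
def CSA.tensor (A B : CSA.{u, u} k) : CSA.{u, u} k :=
  have := isSimpleRing_tensorProduct k A B
  have := isCentral_tensorProduct k A B
  CSA.ofAlgebra k (A ⊗[k] B)

/-- The opposite of a central simple algebra. -/
def CSA.op (A : CSA.{u, u} k) : CSA.{u, u} k := CSA.ofAlgebra k Aᵐᵒᵖ

theorem IsBrauerEquivalent.of_algEquiv {A B : CSA.{u, u} k} (e : A ≃ₐ[k] B) :
    IsBrauerEquivalent A B :=
  ⟨1, 1, one_ne_zero, one_ne_zero, ⟨e.mapMatrix⟩⟩

theorem IsBrauerEquivalent.of_matrix {A B : CSA.{u, u} k} {n : ℕ} (hn : n ≠ 0)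
    (e : A ≃ₐ[k] Matrix (Fin n) (Fin n) B) : IsBrauerEquivalent A B :=
  ⟨1, n, one_ne_zero, hn, ⟨(matrixFinOneEquiv k A).trans e⟩⟩

theorem IsBrauerEquivalent.tensor {A A' B B' : CSA.{u, u} k} (h : IsBrauerEquivalent A A')
    (h' : IsBrauerEquivalent B B') : IsBrauerEquivalent (A.tensor B) (A'.tensor B') := by
  obtain ⟨n, m, hn, hm, ⟨e⟩⟩ := h
  obtain ⟨p, q, hp, hq, ⟨e'⟩⟩ := h'
  refine ⟨n * p, m * q, mul_ne_zero hn hp, mul_ne_zero hm hq, ⟨?_⟩⟩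
  exact (Matrix.reindexAlgEquiv k (A ⊗[k] B) finProdFinEquiv).symm.trans <|
    (Matrix.kroneckerTMulAlgEquiv (Fin n) (Fin p) k k A B).symm.trans <|
    (Algebra.TensorProduct.congr e e').trans <|
    (Matrix.kroneckerTMulAlgEquiv (Fin m) (Fin q) k k A' B').trans <|
    Matrix.reindexAlgEquiv k (A' ⊗[k] B') finProdFinEquiv

theorem IsBrauerEquivalent.op {A B : CSA.{u, u} k} (h : IsBrauerEquivalent A B) :
    IsBrauerEquivalent A.op B.op := by
  obtain ⟨n, m, hn, hm, ⟨e⟩⟩ := h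
  let t (C : Type u) [Ring C] [Algebra k C] (r : ℕ) :
      Matrix (Fin r) (Fin r) Cᵐᵒᵖ ≃ₐ[k] (Matrix (Fin r) (Fin r) C)ᵐᵒᵖ := AlgEquiv.mopMatrix
  exact ⟨n, m, hn, hm, ⟨(t A n).trans <| (AlgEquiv.op e).trans (t B m).symm⟩⟩

theorem CSA.op_tensor_self (A : CSA.{u, u} k) :
    IsBrauerEquivalent (A.op.tensor A) (CSA.ofAlgebra k k) := by
  let e : A ⊗[k] Aᵐᵒᵖ ≃ₐ[k] Module.End k A :=
    AlgEquiv.ofBijective _ (mulLeftRight_bijective_of_central_simple k A)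
  exact .of_matrix (Module.finrank_pos (R := k) (M := A)).ne' <|
    (Algebra.TensorProduct.comm k Aᵐᵒᵖ A).trans <| e.trans <|
      algEquivMatrix (Module.finBasis k A)

/-- The group law on the set `BrauerGroup k` of similarity classes of central simple `k`-algebras:
the product is the tensor product over `k`, the unit is the class of `k`, and the inverse is
the class of the opposite algebra. -/
instance BrauerGroup.instCommGroup : CommGroup (BrauerGroup.{u, u} k) where
  mul := Quotient.map₂ CSA.tensor fun _ _ h _ _ h' => IsBrauerEquivalent.tensor h h'
  one := Quotient.mk _ (CSA.ofAlgebra k k)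
  inv := Quotient.map CSA.op fun _ _ h => IsBrauerEquivalent.op h
  mul_assoc := by
    rintro ⟨A⟩ ⟨B⟩ ⟨C⟩
    exact Quotient.sound (.of_algEquiv (Algebra.TensorProduct.assoc k k k A B C))
  one_mul := by
    rintro ⟨A⟩
    exact Quotient.sound (.of_algEquiv (Algebra.TensorProduct.lid k A))
  mul_one := by
    rintro ⟨A⟩
    exact Quotient.sound (.of_algEquiv (Algebra.TensorProduct.rid k k A))
  inv_mul_cancel := by
    rintro ⟨A⟩
    exact Quotient.sound A.op_tensor_self
  mul_comm := by
    rintro ⟨A⟩ ⟨B⟩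
    exact Quotient.sound (.of_algEquiv (Algebra.TensorProduct.comm k A B))

/-- `A` splits over `L`: the `L`-algebra `L ⊗ A` is a matrix algebra over `L`. -/
def CSA.SplitBy (A : CSA.{u, u} k) (L : Type v) [Field L] [Algebra k L] : Prop :=
  ∃ n : ℕ, Nonempty (L ⊗[k] A ≃ₐ[L] Matrix (Fin n) (Fin n) L)

theorem CSA.SplitBy.one (L : Type v) [Field L] [Algebra k L] : (CSA.ofAlgebra k k).SplitBy L :=
  ⟨1, ⟨(Algebra.TensorProduct.rid k L L).trans
    (matrixFinOneEquiv L L).symm⟩⟩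

theorem CSA.SplitBy.tensor {A B : CSA.{u, u} k} {L : Type v} [Field L] [Algebra k L]
    (hA : A.SplitBy L) (hB : B.SplitBy L) : (A.tensor B).SplitBy L := by
  obtain ⟨n, ⟨e⟩⟩ := hA
  obtain ⟨m, ⟨e'⟩⟩ := hB
  refine ⟨n * 1 * m, ⟨?_⟩⟩
  exact (Algebra.TensorProduct.assoc k k L L A B).symm.trans <|
    (Algebra.TensorProduct.congr e
      (matrixFinOneEquiv k B).symm).trans <|
    (Matrix.kroneckerTMulAlgEquiv (Fin n) (Fin 1) k L L B).trans <|
    e'.mapMatrix.trans <|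
    (Matrix.compAlgEquiv (Fin n × Fin 1) (Fin m) L L).trans <|
    Matrix.reindexAlgEquiv L L
      ((Equiv.prodCongr finProdFinEquiv (Equiv.refl (Fin m))).trans finProdFinEquiv)

theorem CSA.SplitBy.op {A : CSA.{u, u} k} {L : Type v} [Field L] [Algebra k L]
    (hA : A.SplitBy L) : A.op.SplitBy L := by
  obtain ⟨n, ⟨e⟩⟩ := hA
  refine ⟨n, ⟨?_⟩⟩
  exact (Algebra.TensorProduct.congr (AlgEquiv.toOpposite L L)
      (AlgEquiv.refl (R := k) (A₁ := (Aᵐᵒᵖ : Type u)))).trans <|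
    (Algebra.TensorProduct.opAlgEquiv k L L A).trans <|
    (AlgEquiv.op e).trans (Matrix.transposeAlgEquiv (Fin n) L L).symm

/-- The relative Brauer group `Br(k | L)`: the subgroup of the Brauer group of `k` formed by
the similarity classes of central simple `k`-algebras that split over `L`. -/
def relativeBrauerGroup (k : Type u) [Field k] (L : Type v) [Field L] [Algebra k L] :
    Subgroup (BrauerGroup.{u, u} k) where
  carrier := {x | ∃ A : CSA.{u, u} k, A.SplitBy L ∧ Quotient.mk _ A = x}
  one_mem' := ⟨_, CSA.SplitBy.one L, rfl⟩
  mul_mem' := by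
    rintro _ _ ⟨A, hA, rfl⟩ ⟨B, hB, rfl⟩
    exact ⟨A.tensor B, hA.tensor hB, rfl⟩
  inv_mem' := by
    rintro _ ⟨A, hA, rfl⟩
    exact ⟨A.op, hA.op, rfl⟩

end Brauer

/-! ### First group cohomology of a `G`-module -/

section H1

variable {G : Type u} [Group G] {V : Type v} [AddCommGroup V] [Module ℤ V]

/-- The group of 1-cocycles: the maps `c` with `c (g h) = c g + g • c h`. -/
def oneCocycles (ρ : Representation ℤ G V) : AddSubgroup (G → V) where
  carrier := {c | ∀ g h : G, c (g * h) = c g + ρ g (c h)}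
  zero_mem' := by intro g h; simp
  add_mem' := by
    intro c d hc hd g h
    simp only [Pi.add_apply, hc g h, hd g h, map_add]
    abel
  neg_mem' := by
    intro c hc g h
    simp only [Pi.neg_apply, hc g h, map_neg]
    abel

/-- The 1-cocycles that are coboundaries: those of the form `g ↦ g • a - a`. -/
def oneCoboundaries (ρ : Representation ℤ G V) : AddSubgroup (oneCocycles ρ) where
  carrier := {c | ∃ a : V, ∀ g : G, c.1 g = ρ g a - a}
  zero_mem' := ⟨0, fun g => by simp⟩
  add_mem' := by
    rintro c d ⟨a, ha⟩ ⟨b, hb⟩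
    exact ⟨a + b, fun g => by
      rw [AddSubgroup.coe_add, Pi.add_apply, ha, hb, map_add]; abel⟩
  neg_mem' := by
    rintro c ⟨a, ha⟩
    exact ⟨-a, fun g => by rw [AddSubgroup.coe_neg, Pi.neg_apply, ha, map_neg]; abel⟩

/-- `H¹(G, V)`, with 1-cocycles modulo coboundaries. (Mathlib's `groupCohomology.H1` requires the
group to live in the universe of the coefficient ring `ℤ`.) -/
abbrev FirstCohomology (ρ : Representation ℤ G V) : Type _ := oneCocycles ρ ⧸ oneCoboundaries ρ

end H1

/-! ### `G`-integers and the module `U ⊗ Kˣ` -/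

section GInteger

variable {k : Type u} {K : Type v} [Field k] [Field K] [Algebra k K]

/-- The canonical subgroup `{g | g • 1 = 1}` of a `G`-integer, that is, of the additive group `ℤ`
with an action `U` of `G`. -/
def canonicalSubgroup {G : Type u} [Group G] (U : Representation ℤ G ℤ) : Subgroup G where
  carrier := {g | U g 1 = 1}
  one_mem' := by simp
  mul_mem' := by
    intro g h hg hh
    simp only [Set.mem_ofPred_eq] at hg hh ⊢
    rw [map_mul, Module.End.mul_apply, hh, hg]
  inv_mem' := by
    intro g hg
    simp only [Set.mem_ofPred_eq] at hg ⊢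
    have h : U (g⁻¹ * g) 1 = 1 := by simp
    rwa [map_mul, Module.End.mul_apply, hg] at h

/-- The `G`-module `U ⊗ Kˣ` for `G = Gal(K/k)` and a `G`-integer `U`, with the simultaneous action
`g • (m ⊗ x) = (g • m) ⊗ g x`; the group `Kˣ` is written additively. -/
noncomputable def twistedUnits (U : Representation ℤ Gal(K/k) ℤ) :=
  U.tprod (Representation.ofMulDistribMulAction Gal(K/k) Kˣ)

theorem apply_one_of_notMem {G : Type u} [Group G] {U : Representation ℤ G ℤ} {g : G}
    (hg : g ∉ canonicalSubgroup U) : U g 1 = -1 := by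
  have hlin : ∀ n : ℤ, U g n = n * U g 1 := fun n => by
    have := (U g).map_smul n 1
    rwa [smul_eq_mul, mul_one, smul_eq_mul] at this
  have h : U (g * g⁻¹) 1 = 1 := by simp
  rw [map_mul, Module.End.mul_apply, hlin] at h
  exact (Int.isUnit_iff.1 (IsUnit.of_mul_eq_one_right _ h)).resolve_left hg

/-- For `a ∈ kˣ`, the element `1 ⊗ a` of `U ⊗ Kˣ`. -/
noncomputable def oneTmulUnit (K : Type v) [Field K] [Algebra k K] (a : kˣ) :
    TensorProduct ℤ ℤ (Additive Kˣ) :=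
  (1 : ℤ) ⊗ₜ[ℤ] Additive.ofMul (Units.map (algebraMap k K : k →* K) a)

theorem twistedUnits_apply_oneTmulUnit (U : Representation ℤ Gal(K/k) ℤ) (g : Gal(K/k)) (a : kˣ) :
    twistedUnits U g (oneTmulUnit K a) = U g 1 • oneTmulUnit K a := by
  have h : g • Units.map (algebraMap k K : k →* K) a = Units.map (algebraMap k K : k →* K) a := by
    ext
    exact g.commutes a
  rw [twistedUnits, Representation.tprod_apply, oneTmulUnit, TensorProduct.map_tmul,
    Representation.ofMulDistribMulAction_apply_apply, toMul_ofMul, h, TensorProduct.smul_tmul',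
    smul_eq_mul, mul_one]

open Classical in
/-- For `a ∈ kˣ`, the 1-cocycle with value `1 ⊗ a` outside the canonical subgroup and trivial
value on the canonical subgroup. -/
noncomputable def stepCocycle (U : Representation ℤ Gal(K/k) ℤ) (a : kˣ) :
    oneCocycles (twistedUnits U) :=
  ⟨fun g => if g ∈ canonicalSubgroup U then 0 else oneTmulUnit K a, by
    intro g h
    have hgh : U (g * h) 1 = U g 1 * U h 1 := by
      have := (U g).map_smul (U h 1) 1
      rw [map_mul, Module.End.mul_apply]
      rw [← mul_comm, ← smul_eq_mul, ← this, smul_eq_mul, mul_one]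
    beta_reduce
    have hmem : ∀ x, x ∈ canonicalSubgroup U ↔ U x 1 = 1 := fun x => Iff.rfl
    by_cases hg : g ∈ canonicalSubgroup U
    · have hU := (hmem g).1 hg
      by_cases hh : h ∈ canonicalSubgroup U
      · rw [if_pos (mul_mem hg hh), if_pos hg, if_pos hh, map_zero, add_zero]
      · have : g * h ∉ canonicalSubgroup U := by
          rw [hmem, hgh, hU, apply_one_of_notMem hh]; decide
        rw [if_neg this, if_pos hg, if_neg hh, twistedUnits_apply_oneTmulUnit, hU, one_smul,
          zero_add]
    · have hU := apply_one_of_notMem hg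
      by_cases hh : h ∈ canonicalSubgroup U
      · have : g * h ∉ canonicalSubgroup U := by
          rw [hmem, hgh, hU, (hmem h).1 hh]; decide
        rw [if_neg this, if_neg hg, if_pos hh, map_zero, add_zero]
      · have : g * h ∈ canonicalSubgroup U := by
          rw [hmem, hgh, hU, apply_one_of_notMem hh]; decide
        rw [if_pos this, if_neg hg, if_neg hh, twistedUnits_apply_oneTmulUnit, hU, neg_smul,
          one_smul, add_neg_cancel]⟩

/-- The class of `stepCocycle U a` in `H¹(Gal(K/k), U ⊗ Kˣ)`. -/
noncomputable def stepClass (U : Representation ℤ Gal(K/k) ℤ) (a : kˣ) :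
    FirstCohomology (twistedUnits U) :=
  QuotientAddGroup.mk (stepCocycle U a)

end GInteger

/-! ### Cyclic algebras -/

/-- For a finite cyclic Galois extension `L/k` of degree `n`, a generator `σ` of its Galois group
and `a ∈ kˣ`, a central simple `k`-algebra `A` is (isomorphic to) the cyclic algebra `(L/k, σ, a)`:
it has dimension `n²`, contains `L`, and has an element `u` with `uⁿ = a` and `u x = σ(x) u` for
all `x ∈ L`. For `n = 2` this is `L ⊕ L u` with `u² = a`. -/
def CSA.IsCyclicAlgebra {k : Type u} [Field k] (A : CSA.{u, u} k) {L : Type v} [Field L]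
    [Algebra k L] (σ : Gal(L/k)) (a : kˣ) : Prop :=
  Module.finrank k A = Module.finrank k L ^ 2 ∧
    ∃ (f : L →ₐ[k] A) (u : A), u ^ Module.finrank k L = algebraMap k A a ∧
      ∀ x : L, u * f x = f (σ x) * u

/-! Both groups are the quotient of `kˣ` by the norms from `L`. Since `ℤ` has only the automorphisms
`±1`, the subgroup `I` has index at most two, so `L` is `k` or a quadratic Galois extension. It
suffices to give surjections from `kˣ` onto the two groups with the norms as common kernel;
`MonoidHom.exists_mulEquiv_of_surjective` then matches them.

On the cohomology side, `I` acts on `Kˣ` in the usual way. Hilbert 90 for `K/L` therefore makes any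
cocycle trivial on `I`, and the cocycle relation leaves one value outside `I`, fixed by `G`
(`stepClass_surjective`). Outside `I` the action is also inverted, so coboundaries produce products
`x * g x`, which are norms from `L` (`stepHom_eq_one_iff`).

On the Brauer side, let `L/k` be quadratic with conjugation `σ`. An algebra split by `L` is cut out
of a matrix algebra over `L` by `P * σ(M) = M * P`, with `P * σ(P)` a scalar `c` of `kˣ`
(`CSA.SplitBy.exists_hasDescentDatum`). On column vectors it commutes with `L` and with the
semilinear map `v ↦ P σ(v)`, whose square is `c`; these generate the cyclic algebra of `c`. A
dimension count makes the two classes inverse to each other (`CSA.HasDescentDatum.brauerClass_mul`).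
A cyclic algebra has such a datum with its own constant, so its class is its own inverse and `c`
determines the class. Kronecker products of data multiply the constants, which gives
multiplicativity. The class of the cyclic algebra of `a` is trivial exactly when the algebra acts on
a plane over `k`, that is, on a line over `L`, and this says that `a` is a norm. -/

/-! ### Quadratic Galois extensions -/

/-- `σ` is the nontrivial automorphism of a quadratic Galois extension `L/k`. -/
structure IsQuadraticConj {k : Type u} {L : Type v} [Field k] [Field L] [Algebra k L]
    (σ : Gal(L/k)) : Prop where
  finrank_eq : Module.finrank k L = 2
  apply_apply : ∀ x, σ (σ x) = x
  exists_ne : ∃ x, σ x ≠ x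
  mem_of_fixed : ∀ x, σ x = x → ∃ c : k, algebraMap k L c = x
  norm_eq : ∀ x, algebraMap k L (Algebra.norm k x) = x * σ x

theorem IsQuadraticConj.of_ne_one {k : Type u} {L : Type v} [Field k] [Field L] [Algebra k L]
    [IsGalois k L] (h : Module.finrank k L = 2) {σ : Gal(L/k)} (hσ : σ ≠ 1) :
    IsQuadraticConj σ := by
  have hfin : FiniteDimensional k L := FiniteDimensional.of_finrank_pos (by omega)
  have hcard : Nat.card Gal(L/k) = 2 := by rw [IsGalois.card_aut_eq_finrank, h]
  have hall : ∀ τ : Gal(L/k), τ = 1 ∨ τ = σ := by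
    intro τ
    obtain ⟨a, b, hab, huniv⟩ := Nat.card_eq_two_iff.1 hcard
    have m : ∀ x : Gal(L/k), x = a ∨ x = b := fun x => by
      have : x ∈ ({a, b} : Set Gal(L/k)) := huniv ▸ Set.mem_univ x
      simpa using this
    have h1 := m 1; have h2 := m σ; have h3 := m τ
    grind
  have hsq : σ * σ = 1 := by
    rcases hall (σ * σ) with h | h
    · exact h
    · exact absurd (mul_eq_left.1 h) hσ
  refine ⟨h, fun x => ?_, ?_, fun x hx => ?_, fun x => ?_⟩
  · exact DFunLike.congr_fun hsq x
  · by_contra! hc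
    exact hσ (AlgEquiv.ext hc)
  · refine (IsGalois.mem_range_algebraMap_iff_fixed x).2 fun τ => ?_
    rcases hall τ with rfl | rfl
    · rfl
    · exact hx
  · rw [Algebra.norm_eq_prod_automorphisms]
    classical
    have : (Finset.univ : Finset Gal(L/k)) = {1, σ} := by
      ext τ; simpa using hall τ
    rw [this, Finset.prod_pair hσ.symm]
    rfl

/-- The algebra `B` is `f(L) ⊕ f(L) u` with `u² = a` and `u f(x) = f(σ x) u`. -/
structure IsQuadraticCyclic {k : Type u} {L : Type v} {B : Type w} [Field k] [Field L] [Ring B]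
    [Algebra k L] [Algebra k B] (σ : Gal(L/k)) (a : kˣ) (f : L →ₐ[k] B) (u : B) : Prop where
  finrank_eq : Module.finrank k B = 4
  mul_self : u * u = algebraMap k B a
  mul_map : ∀ x, u * f x = f (σ x) * u

/-! ### Structure of quadratic cyclic algebras -/

namespace IsQuadraticCyclic

variable {k : Type u} {L : Type v} {B : Type w} [Field k] [Field L] [Ring B]
    [Algebra k L] [Algebra k B] {σ : Gal(L/k)} {a : kˣ} {f : L →ₐ[k] B} {u : B}

theorem nontrivial (h : IsQuadraticCyclic σ a f u) : Nontrivial B :=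
  Module.nontrivial_of_finrank_pos (R := k) (by rw [h.finrank_eq]; norm_num)

theorem isUnit (h : IsQuadraticCyclic σ a f u) : IsUnit u := by
  exact ((Commute.refl u).isUnit_mul_iff.1 (h.mul_self ▸ a.isUnit.map _)).1

/-- If `y ≠ 0`, the relation puts `u` in the commutative subring `f(L)`. Then `u` commutes with
every `f t`, although conjugation by `u` induces `σ ≠ 1`. -/
theorem injective (h : IsQuadraticCyclic σ a f u) (hσ : IsQuadraticConj σ) {x y : L}
    (hxy : f x + f y * u = 0) : x = 0 ∧ y = 0 := by
  have := h.nontrivial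
  have hy : y = 0 := by
    by_contra hy
    obtain ⟨t, ht⟩ := hσ.exists_ne
    have hu : u = f (-(y⁻¹ * x)) := by
      have h1 : f y⁻¹ * (f x + f y * u) = 0 := by rw [hxy, mul_zero]
      rw [mul_add, ← mul_assoc, ← map_mul, ← map_mul, inv_mul_cancel₀ hy, map_one, one_mul] at h1
      rw [map_neg, eq_neg_iff_add_eq_zero, add_comm, h1]
    have h2 : f t * u = f (σ t) * u := by
      rw [← h.mul_map t, hu, ← map_mul, ← map_mul, mul_comm]
    exact ht (f.injective (h.isUnit.mul_left_injective h2)).symm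
  subst hy
  refine ⟨f.injective ?_, rfl⟩
  simpa using hxy

/-- The `k`-linear map `(x, y) ↦ f x + f y u`. -/
def toLinearMap (f : L →ₐ[k] B) (u : B) : L × L →ₗ[k] B :=
  f.toLinearMap.coprod ((LinearMap.mulRight k u).comp f.toLinearMap)

theorem bijective (h : IsQuadraticCyclic σ a f u) (hσ : IsQuadraticConj σ) :
    Function.Bijective (toLinearMap f u) := by
  have hB : FiniteDimensional k B := FiniteDimensional.of_finrank_pos (by rw [h.finrank_eq]; simp)
  have hL : FiniteDimensional k L := FiniteDimensional.of_finrank_pos (by rw [hσ.finrank_eq]; simp)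
  have hinj : Function.Injective (toLinearMap f u) := by
    rw [injective_iff_map_eq_zero]
    rintro ⟨x, y⟩ hxy
    obtain ⟨rfl, rfl⟩ := h.injective hσ hxy
    rfl
  refine ⟨hinj, (LinearMap.injective_iff_surjective_of_finrank_eq_finrank ?_).1 hinj⟩
  rw [Module.finrank_prod, hσ.finrank_eq, h.finrank_eq]

theorem exists_eq (h : IsQuadraticCyclic σ a f u) (hσ : IsQuadraticConj σ) (b : B) :
    ∃ x y : L, b = f x + f y * u := by
  obtain ⟨⟨x, y⟩, hx⟩ := (h.bijective hσ).2 b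
  exact ⟨x, y, hx.symm⟩

theorem mul_eq (h : IsQuadraticCyclic σ a f u) (x y z t : L) :
    (f x + f y * u) * (f z + f t * u) =
      f (x * z + a.val • (y * σ t)) + f (x * t + y * σ z) * u := by
  have h1 : f y * u * f z = f (y * σ z) * u := by rw [mul_assoc, h.mul_map, ← mul_assoc, map_mul]
  have h2 : f y * u * (f t * u) = f (a.val • (y * σ t)) := by
    rw [mul_assoc, ← mul_assoc u, h.mul_map, mul_assoc, h.mul_self, ← mul_assoc, map_smul, map_mul,
      ← Algebra.commutes, Algebra.smul_def]
  rw [add_mul, mul_add, mul_add, h1, h2, map_add, map_add, map_mul f x z, map_mul f x t, add_mul]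
  noncomm_ring

/-- Bracketing with `f t` kills the `f(L)`-component and, when `σ t ≠ t`, only rescales the other
one by a unit. Simplicity and centrality both rest on this. -/
theorem commutator_eq (h : IsQuadraticCyclic σ a f u) (t x y : L) :
    f t * (f x + f y * u) - (f x + f y * u) * f t = f ((t - σ t) * y) * u := by
  rw [mul_add, add_mul, mul_assoc _ u, h.mul_map, sub_mul, map_sub, sub_mul, map_mul, map_mul,
    ← map_mul f t x, mul_comm t x, map_mul, ← mul_assoc (f y), ← map_mul f y, mul_comm y,
    map_mul]
  noncomm_ring

/-- A nonzero element of an ideal either lies in `f(L)` and is a unit, or has a bracket with some `f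
t` that is a unit times `u`. -/
theorem isSimpleRing (h : IsQuadraticCyclic σ a f u) (hσ : IsQuadraticConj σ) :
    IsSimpleRing B := by
  have := h.nontrivial
  refine .of_eq_bot_or_eq_top fun I => ?_
  by_cases hI : ∀ w ∈ I, w = 0
  · left
    exact le_antisymm (fun w hw => (TwoSidedIdeal.mem_bot _).2 (hI w hw)) bot_le
  right
  push Not at hI
  obtain ⟨w, hw, hw0⟩ := hI
  have key : ∀ b : B, IsUnit b → b ∈ I → I = ⊤ := by
    rintro _ ⟨b, rfl⟩ hb
    rw [← TwoSidedIdeal.one_mem_iff, ← b.inv_mul]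
    exact I.mul_mem_left _ _ hb
  obtain ⟨x, y, rfl⟩ := h.exists_eq hσ w
  obtain ⟨t, ht⟩ := hσ.exists_ne
  by_cases hy : y = 0
  · subst hy
    rw [map_zero, zero_mul, add_zero] at hw hw0
    have hx : x ≠ 0 := by rintro rfl; exact hw0 (map_zero _)
    exact key _ (hx.isUnit.map f) hw
  · have h1 : f t * (f x + f y * u) - (f x + f y * u) * f t = f ((t - σ t) * y) * u := h.commutator_eq t x y
    have hne : (t - σ t) * y ≠ 0 := mul_ne_zero (sub_ne_zero.2 ht.symm) hy
    refine key _ ((hne.isUnit.map f).mul h.isUnit) (h1 ▸ I.sub_mem ?_ ?_)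
    · exact I.mul_mem_left _ _ hw
    · exact I.mul_mem_right _ _ hw

theorem isCentral (h : IsQuadraticCyclic σ a f u) (hσ : IsQuadraticConj σ) :
    Algebra.IsCentral k B := by
  refine ⟨fun z hz => ?_⟩
  have hz := Subalgebra.mem_center_iff.1 hz
  obtain ⟨x, y, rfl⟩ := h.exists_eq hσ z
  obtain ⟨t, ht⟩ := hσ.exists_ne
  have hy : y = 0 := by
    have h1 := hz (f t)
    have h2 : f 0 + f ((t - σ t) * y) * u = 0 := by
      rw [map_zero, zero_add, ← h.commutator_eq t x y, h1, sub_self]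
    exact (mul_eq_zero.1 (h.injective hσ h2).2).resolve_left (sub_ne_zero.2 ht.symm)
  subst hy
  have h1 := hz u
  simp only [map_zero, zero_mul, add_zero] at h1 ⊢
  rw [h.mul_map] at h1
  have := h.nontrivial
  obtain ⟨c, rfl⟩ := hσ.mem_of_fixed x (f.injective (h.isUnit.mul_left_injective h1))
  exact Algebra.mem_bot.2 ⟨c, (f.commutes c).symm⟩

/-- The universal property of a quadratic cyclic algebra. -/
theorem exists_lift (h : IsQuadraticCyclic σ a f u) (hσ : IsQuadraticConj σ) {R : Type*} [Ring R]
    [Algebra k R] (g : L →ₐ[k] R) (r : R) (hr : r * r = algebraMap k R a)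
    (hg : ∀ x, r * g x = g (σ x) * r) :
    ∃ F : B →ₐ[k] R, (∀ x, F (f x) = g x) ∧ F u = r := by
  let e := LinearEquiv.ofBijective _ (h.bijective hσ)
  let F₀ : B →ₗ[k] R := (toLinearMap g r).comp e.symm.toLinearMap
  have hF : ∀ x y, F₀ (f x + f y * u) = g x + g y * r := by
    intro x y
    have : e.symm (f x + f y * u) = (x, y) := by
      rw [LinearEquiv.symm_apply_eq]; rfl
    change toLinearMap g r (e.symm (f x + f y * u)) = _
    rw [this]; rfl
  have hF1 : ∀ x, F₀ (f x) = g x := fun x => by simpa using hF x 0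
  have hFu : F₀ u = r := by simpa using hF 0 1
  refine ⟨AlgHom.ofLinearMap F₀ ?_ ?_, hF1, hFu⟩
  · simpa using hF1 1
  · intro b c
    obtain ⟨x, y, rfl⟩ := h.exists_eq hσ b
    obtain ⟨z, t, rfl⟩ := h.exists_eq hσ c
    rw [h.mul_eq, hF, hF, hF]
    have h1 : g y * r * g z = g (y * σ z) * r := by rw [mul_assoc, hg, ← mul_assoc, map_mul]
    have h2 : g y * r * (g t * r) = g (a.val • (y * σ t)) := by
      rw [mul_assoc, ← mul_assoc r, hg, mul_assoc, hr, ← mul_assoc, map_smul, map_mul,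
        ← Algebra.commutes, Algebra.smul_def]
    rw [add_mul, mul_add, mul_add, h1, h2, map_add, map_add, map_mul g x z, map_mul g x t, add_mul]
    noncomm_ring

end IsQuadraticCyclic

namespace CSA.IsCyclicAlgebra

variable {k : Type u} {L : Type v} [Field k] [Field L] [Algebra k L] {σ : Gal(L/k)} {a : kˣ}
  {A : CSA.{u, u} k}

theorem iff_of_isQuadraticConj (hσ : IsQuadraticConj σ) :
    A.IsCyclicAlgebra σ a ↔ ∃ (f : L →ₐ[k] A) (u : A), IsQuadraticCyclic σ a f u := by
  rw [CSA.IsCyclicAlgebra, hσ.finrank_eq]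
  constructor
  · rintro ⟨h, f, u, hu, hf⟩
    exact ⟨f, u, h, by rw [← sq, hu], hf⟩
  · rintro ⟨f, u, h⟩
    exact ⟨h.finrank_eq, f, u, by rw [sq, h.mul_self], h.mul_map⟩

end CSA.IsCyclicAlgebra

/-! ### Brauer classes -/

section BrauerClass

variable {k : Type u} [Field k]

/-- The class of a central simple algebra in the Brauer group. -/
abbrev CSA.brauerClass (A : CSA.{u, u} k) : BrauerGroup.{u, u} k := Quotient.mk _ A

theorem CSA.brauerClass_eq_iff {A B : CSA.{u, u} k} :
    A.brauerClass = B.brauerClass ↔ IsBrauerEquivalent A B :=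
  Quotient.eq (r := Brauer.CSA_Setoid k)

theorem CSA.brauerClass_tensor (A B : CSA.{u, u} k) :
    (A.tensor B).brauerClass = A.brauerClass * B.brauerClass := rfl

theorem CSA.brauerClass_self : (CSA.ofAlgebra k k).brauerClass = 1 := rfl

/-- Two central simple algebras that act on a space of the right dimension by commuting
endomorphisms have mutually inverse classes. -/
theorem CSA.brauerClass_mul_eq_one_of_commute (A B : CSA.{u, u} k) {V : Type*} [AddCommGroup V]
    [Module k V] (ρ : A →ₐ[k] Module.End k V) (τ : B →ₐ[k] Module.End k V)
    (hcomm : ∀ a b, Commute (ρ a) (τ b))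
    (hdim : Module.finrank k A * Module.finrank k B = Module.finrank k V ^ 2) :
    A.brauerClass * B.brauerClass = 1 := by
  have hA : 0 < Module.finrank k A := Module.finrank_pos
  have hB : 0 < Module.finrank k B := Module.finrank_pos
  have hV : 0 < Module.finrank k V := by
    by_contra! h
    rw [Nat.le_zero.1 h] at hdim
    have := Nat.mul_pos hA hB
    omega
  have : FiniteDimensional k V := FiniteDimensional.of_finrank_pos hV
  have := isSimpleRing_tensorProduct k A B
  have : Nontrivial V := Module.nontrivial_of_finrank_pos hV
  let F : A ⊗[k] B →ₐ[k] Module.End k V := Algebra.TensorProduct.lift ρ τ hcomm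
  -- `A ⊗ B` is simple, so the joint action is faithful; `hdim` then makes it the full endomorphism
  -- algebra.
  have hF : Function.Injective F := F.toRingHom.injective
  have hF' : Function.Bijective F := by
    refine ⟨hF, ?_⟩
    refine (LinearMap.injective_iff_surjective_of_finrank_eq_finrank
      (f := F.toLinearMap) ?_).1 hF
    rw [Module.finrank_tensorProduct, hdim, Module.finrank_linearMap, sq]
  rw [← CSA.brauerClass_tensor, ← CSA.brauerClass_self, CSA.brauerClass_eq_iff]
  exact .of_matrix hV.ne' ((AlgEquiv.ofBijective F hF').trans (algEquivMatrix (Module.finBasis k V)))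

/-- A central simple algebra with trivial class acts on a space of the dimension for which
it is the full endomorphism algebra of that space. -/
theorem CSA.exists_action_of_brauerClass_eq_one {A : CSA.{u, u} k} (h : A.brauerClass = 1) :
    ∃ (V : Type u) (_ : AddCommGroup V) (_ : Module k V) (_ : A →ₐ[k] Module.End k V),
      Module.finrank k A = Module.finrank k V ^ 2 := by
  rw [← CSA.brauerClass_self, CSA.brauerClass_eq_iff] at h
  obtain ⟨n, m, hn, hm, ⟨e⟩⟩ := h
  have : NeZero n := ⟨hn⟩
  let g : Matrix (Fin n) (Fin n) A ≃ₐ[k] Module.End k (Fin m → k) :=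
    e.trans Matrix.toLinAlgEquiv'
  -- Morita reduction: the matrix units of `M_n(A)` act on `k^m`, the idempotent `E 0 0 1` cuts out
  -- a subspace `V` on which `A` acts, and the units `E 0 i 1` identify `k^m` with `n` copies of
  -- `V`.
  let E (i j : Fin n) (a : A) : Module.End k (Fin m → k) := g (Matrix.single i j a)
  have hE : ∀ i j l a b, E i j a * E j l b = E i l (a * b) := fun i j l a b => by
    simp only [E, ← map_mul, Matrix.single_mul_single_same]
  have hE' : ∀ i j l r a b, j ≠ l → E i j a * E l r b = 0 := fun i j l r a b hjl => by
    simp only [E, ← map_mul, Matrix.single_mul_single_of_ne _ _ _ _ hjl, map_zero]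
  have hE1 : ∑ i, E i i 1 = 1 := by
    simp only [E, ← map_sum, Matrix.sum_single_one, map_one]
  let V : Submodule k (Fin m → k) := LinearMap.range (E 0 0 1)
  have hV : ∀ v ∈ V, E 0 0 1 v = v := by
    rintro _ ⟨w, rfl⟩
    rw [← Module.End.mul_apply, hE, one_mul]
  have hmem : ∀ j a v, E 0 j a v ∈ V := fun j a v =>
    ⟨E 0 j a v, by rw [← Module.End.mul_apply, hE, one_mul]⟩
  let ρ : A →ₐ[k] Module.End k V :=
    { toFun := fun a => (E 0 0 a).restrict fun v _ => hmem 0 a v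
      map_one' := by ext1 v; exact Subtype.ext (hV v v.2)
      map_mul' := fun a b => by
        ext1 v
        refine Subtype.ext ?_
        change E 0 0 (a * b) v = E 0 0 a (E 0 0 b v)
        rw [← Module.End.mul_apply, hE]
      map_zero' := by
        ext1 v
        refine Subtype.ext ?_
        change E 0 0 0 v = 0
        simp [E]
      map_add' := fun a b => by
        ext1 v
        refine Subtype.ext ?_
        change E 0 0 (a + b) v = E 0 0 a v + E 0 0 b v
        simp [E, Matrix.single_add]
      commutes' := fun r => by
        ext1 v
        refine Subtype.ext ?_
        change E 0 0 (algebraMap k A r) v = r • (v : Fin m → k)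
        conv_rhs => rw [← hV v v.2]
        rw [Algebra.algebraMap_eq_smul_one]
        simp only [E, ← Matrix.smul_single, map_smul, LinearMap.smul_apply] }
  let φ : (Fin m → k) ≃ₗ[k] (Fin n → V) :=
    { toFun := fun w i => ⟨E 0 i 1 w, hmem i 1 w⟩
      map_add' := fun _ _ => by ext1 i; exact Subtype.ext (map_add _ _ _)
      map_smul' := fun _ _ => by ext1 i; exact Subtype.ext (map_smul _ _ _)
      invFun := fun v => ∑ i, E i 0 1 (v i)
      left_inv := fun w => by
        change ∑ i, E i 0 1 (E 0 i 1 w) = w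
        simp only [← Module.End.mul_apply, hE, one_mul]
        rw [← LinearMap.sum_apply, hE1, Module.End.one_apply]
      right_inv := fun v => by
        ext1 j
        refine Subtype.ext ?_
        change E 0 j 1 (∑ i, E i 0 1 (v i)) = v j
        rw [map_sum, Finset.sum_eq_single j]
        · rw [← Module.End.mul_apply, hE, one_mul, hV _ (v j).2]
        · intro i _ hij
          rw [← Module.End.mul_apply, hE' _ _ _ _ _ _ hij.symm, LinearMap.zero_apply]
        · simp }
  have h1 : m = n * Module.finrank k V := by
    have := φ.finrank_eq
    rwa [Module.finrank_fin_fun, Module.finrank_pi_fintype, Finset.sum_const, Finset.card_univ,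
      Fintype.card_fin, smul_eq_mul] at this
  have h2 : n * n * Module.finrank k A = m * m := by
    have := g.toLinearEquiv.finrank_eq
    rwa [Module.finrank_matrix, Fintype.card_fin, Module.finrank_linearMap,
      Module.finrank_fin_fun] at this
  refine ⟨V, inferInstance, inferInstance, ρ, ?_⟩
  have h3 : n * n * Module.finrank k A = n * n * Module.finrank k V ^ 2 := by
    rw [h2]; nth_rw 1 2 [h1]; ring
  exact Nat.eq_of_mul_eq_mul_left (by positivity) h3

end BrauerClass

/-! ### Algebras given by descent of a matrix algebra along a quadratic extension -/

section Descent

variable {k : Type u} {L : Type v} [Field k] [Field L] [Algebra k L]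

/-- `A` embeds, with the right dimension, into the matrices `M` over `L` with
`P * σ(M) = M * P`, where `P * σ(P)` is the scalar `c`. -/
def CSA.HasDescentDatum (A : CSA.{u, u} k) (σ : Gal(L/k)) (c : kˣ) : Prop :=
  ∃ (ι : Type) (_ : Fintype ι) (_ : DecidableEq ι) (f : A →ₐ[k] Matrix ι ι L) (P : Matrix ι ι L),
    Module.finrank k A = Fintype.card ι ^ 2 ∧ P * P.map σ = c.val • 1 ∧
      ∀ x, P * (f x).map σ = f x * P

/-- Matrices over `L` act `k`-linearly on column vectors. -/
def Matrix.mulVecAlgHom (k : Type u) {L : Type v} [Field k] [Field L] [Algebra k L] (ι : Type w)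
    [Fintype ι] [DecidableEq ι] : Matrix ι ι L →ₐ[k] Module.End k (ι → L) where
  toFun M := M.mulVecLin.restrictScalars k
  map_one' := by refine LinearMap.ext fun v => ?_; simp
  map_mul' M N := by refine LinearMap.ext fun v => ?_; simp
  map_zero' := by refine LinearMap.ext fun v => ?_; simp
  map_add' M N := by refine LinearMap.ext fun v => ?_; simp
  commutes' r := by refine LinearMap.ext fun v => ?_; simp [Algebra.algebraMap_eq_smul_one]

@[simp] theorem Matrix.mulVecAlgHom_apply {ι : Type w} [Fintype ι] [DecidableEq ι]
    (M : Matrix ι ι L) (v : ι → L) : Matrix.mulVecAlgHom k ι M v = M.mulVec v := rfl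

/-- `B` acts on `L^ι` through scalars of `L` and the semilinear map `T = P ∘ σ`, with `T² = c`. The
descent equation says exactly that `T` commutes with `f(A)`. The dimensions fit: `4 |ι|² = (2
|ι|)²`. -/
theorem CSA.HasDescentDatum.brauerClass_mul {A B : CSA.{u, u} k} {σ : Gal(L/k)} {c : kˣ}
    (hA : A.HasDescentDatum σ c) (hσ : IsQuadraticConj σ) (hB : B.IsCyclicAlgebra σ c) :
    A.brauerClass * B.brauerClass = 1 := by
  obtain ⟨f', u, h⟩ := (CSA.IsCyclicAlgebra.iff_of_isQuadraticConj hσ).1 hB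
  obtain ⟨ι, _, _, f, P, hdim, hP, hf⟩ := hA
  have : FiniteDimensional k L := FiniteDimensional.of_finrank_pos (by rw [hσ.finrank_eq]; simp)
  let S : Module.End k (ι → L) := σ.toLinearMap.compLeft ι
  have hS : ∀ v i, S v i = σ (v i) := fun _ _ => rfl
  have hSM : ∀ (M : Matrix ι ι L) v, S (M.mulVec v) = (M.map σ).mulVec (S v) := fun M v => by
    ext i
    simp [hS, Matrix.mulVec, dotProduct]
  let T : Module.End k (ι → L) := Matrix.mulVecAlgHom k ι P * S
  have hT : ∀ v, T v = P.mulVec (S v) := fun _ => rfl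
  obtain ⟨F, hF, hFu⟩ := h.exists_lift hσ (Algebra.lsmul k k (ι → L)) T
    (by
      refine LinearMap.ext fun v => ?_
      rw [Module.End.mul_apply, hT, hT, hSM, Matrix.mulVec_mulVec, hP]
      have : S (S v) = v := by ext i; simp [hS, hσ.apply_apply]
      rw [this, Matrix.smul_mulVec, Matrix.one_mulVec]
      rfl)
    (by
      intro x
      refine LinearMap.ext fun v => ?_
      have : S (x • v) = σ x • S v := by ext i; simp [hS]
      simp only [Module.End.mul_apply, hT, Algebra.lsmul_coe, this, Matrix.mulVec_smul])
  refine A.brauerClass_mul_eq_one_of_commute B ((Matrix.mulVecAlgHom k ι).comp f) F ?_ ?_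
  · intro x b
    obtain ⟨y, z, rfl⟩ := h.exists_eq hσ b
    have h1 : ∀ y, Commute (((Matrix.mulVecAlgHom k ι).comp f) x) (F (f' y)) := fun y => by
      rw [hF]
      refine LinearMap.ext fun v => ?_
      simp [Matrix.mulVec_smul]
    have h2 : Commute (((Matrix.mulVecAlgHom k ι).comp f) x) (F u) := by
      rw [hFu]
      refine LinearMap.ext fun v => ?_
      simp [hT, hSM, hf]
    rw [map_add, map_mul]
    exact (h1 y).add_right ((h1 z).mul_right h2)
  · rw [hdim, h.finrank_eq, Module.finrank_pi_fintype, Finset.sum_const, hσ.finrank_eq,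
      Finset.card_univ, smul_eq_mul]
    ring

open scoped Kronecker in
theorem Matrix.map_kronecker {ι κ : Type*} (σ : Gal(L/k)) (M : Matrix ι ι L) (N : Matrix κ κ L) :
    (M ⊗ₖ N).map σ = M.map σ ⊗ₖ N.map σ := by
  ext
  simp

open scoped Kronecker in
-- The Kronecker product `P ⊗ₖ Q` serves as the matrix for the tensor product. This avoids an
-- explicit equivalence between a product of two cyclic algebras and a third.
theorem CSA.HasDescentDatum.tensor {A B : CSA.{u, u} k} {σ : Gal(L/k)} {c d : kˣ}
    (hA : A.HasDescentDatum σ c) (hB : B.HasDescentDatum σ d) :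
    (A.tensor B).HasDescentDatum σ (c * d) := by
  obtain ⟨ι, _, _, f, P, hdim, hP, hf⟩ := hA
  obtain ⟨κ, _, _, g, Q, hdim', hQ, hg⟩ := hB
  let i₁ : Matrix ι ι L →ₐ[k] Matrix (ι × κ) (ι × κ) L :=
    { toFun := fun M => M ⊗ₖ 1
      map_one' := Matrix.one_kronecker_one
      map_mul' := fun M N => by simp [← Matrix.mul_kronecker_mul]
      map_zero' := Matrix.zero_kronecker _
      map_add' := fun M N => Matrix.add_kronecker _ _ _
      commutes' := fun r => by
        rw [Algebra.algebraMap_eq_smul_one, Matrix.smul_kronecker, Matrix.one_kronecker_one,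
          Algebra.algebraMap_eq_smul_one] }
  let i₂ : Matrix κ κ L →ₐ[k] Matrix (ι × κ) (ι × κ) L :=
    { toFun := fun M => 1 ⊗ₖ M
      map_one' := Matrix.one_kronecker_one
      map_mul' := fun M N => by simp [← Matrix.mul_kronecker_mul]
      map_zero' := Matrix.kronecker_zero _
      map_add' := fun M N => Matrix.kronecker_add _ _ _
      commutes' := fun r => by
        rw [Algebra.algebraMap_eq_smul_one, Matrix.kronecker_smul, Matrix.one_kronecker_one,
          Algebra.algebraMap_eq_smul_one] }
  have hi : ∀ M N, i₁ M * i₂ N = M ⊗ₖ N := fun M N => by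
    change M ⊗ₖ 1 * 1 ⊗ₖ N = _
    rw [← Matrix.mul_kronecker_mul, mul_one, one_mul]
  have hi' : ∀ M N, i₂ N * i₁ M = M ⊗ₖ N := fun M N => by
    change 1 ⊗ₖ N * M ⊗ₖ 1 = _
    rw [← Matrix.mul_kronecker_mul, mul_one, one_mul]
  let F : A ⊗[k] B →ₐ[k] Matrix (ι × κ) (ι × κ) L :=
    Algebra.TensorProduct.lift (i₁.comp f) (i₂.comp g) fun x y => by
      change i₁ (f x) * i₂ (g y) = i₂ (g y) * i₁ (f x)
      rw [hi, hi']
  have hF : ∀ x y, F (x ⊗ₜ y) = f x ⊗ₖ g y := fun x y => by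
    rw [Algebra.TensorProduct.lift_tmul]
    exact hi _ _
  have hFx : ∀ x : A ⊗[k] B, P ⊗ₖ Q * (F x).map σ = F x * P ⊗ₖ Q := fun x => by
    induction x using TensorProduct.induction_on with
    | zero => simp
    | add x y hx hy =>
      rw [map_add, Matrix.map_add _ (map_add σ), mul_add, hx, hy, add_mul]
    | tmul x y =>
      rw [hF, Matrix.map_kronecker, ← Matrix.mul_kronecker_mul, hf, hg, Matrix.mul_kronecker_mul]
  refine ⟨ι × κ, inferInstance, inferInstance, F, P ⊗ₖ Q, ?_, ?_, hFx⟩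
  · change Module.finrank k (A ⊗[k] B) = _
    rw [Module.finrank_tensorProduct, hdim, hdim', Fintype.card_prod]
    ring
  · rw [Matrix.map_kronecker, ← Matrix.mul_kronecker_mul, hP, hQ, Matrix.smul_kronecker,
      Matrix.kronecker_smul, Matrix.one_kronecker_one, smul_smul, Units.val_mul]

theorem CSA.HasDescentDatum.splitBy {A : CSA.{u, u} k} {σ : Gal(L/k)} {c : kˣ}
    (hA : A.HasDescentDatum σ c) : A.SplitBy L := by
  obtain ⟨ι, _, _, f, P, hdim, -, -⟩ := hA
  -- Needed for the matrix ring to be nontrivial, so that simplicity of `L ⊗ A` gives injectivity.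
  have hι : Nonempty ι := by
    by_contra h
    rw [not_nonempty_iff] at h
    rw [Fintype.card_eq_zero] at hdim
    exact (Module.finrank_pos (R := k) (M := A)).ne' hdim
  let F : L ⊗[k] A →ₐ[L] Matrix ι ι L :=
    Algebra.TensorProduct.lift (Algebra.ofId L _) f fun x y => Algebra.commutes _ _
  have := isSimpleRing_tensorProduct k A L
  have : IsSimpleRing (L ⊗[k] A) :=
    .of_ringEquiv (Algebra.TensorProduct.comm k A L).toRingEquiv inferInstance
  have hF : Function.Injective F := F.toRingHom.injective
  have hF' : Function.Bijective F := by
    refine ⟨hF, ?_⟩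
    refine (LinearMap.injective_iff_surjective_of_finrank_eq_finrank
      (f := F.toLinearMap) ?_).1 hF
    rw [Module.finrank_baseChange, hdim, Module.finrank_matrix, Module.finrank_self, sq, mul_one]
  exact ⟨_, ⟨(AlgEquiv.ofBijective F hF').trans
    (Matrix.reindexAlgEquiv L L (Fintype.equivFin ι))⟩⟩

/-- In the standard representation by `2 × 2` matrices, the image `r` of `u` has entries in `k` and
square `a`, so `r` itself serves as `P`. -/
theorem CSA.IsCyclicAlgebra.hasDescentDatum {A : CSA.{u, u} k} {σ : Gal(L/k)} {a : kˣ}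
    (hA : A.IsCyclicAlgebra σ a) (hσ : IsQuadraticConj σ) : A.HasDescentDatum σ a := by
  obtain ⟨f', u, h⟩ := (CSA.IsCyclicAlgebra.iff_of_isQuadraticConj hσ).1 hA
  let g : L →ₐ[k] Matrix (Fin 2) (Fin 2) L :=
    { toFun := fun x => !![x, 0; 0, σ x]
      map_one' := by simp [Matrix.one_fin_two]
      map_mul' := by simp
      map_zero' := by ext i j; fin_cases i <;> fin_cases j <;> simp
      map_add' := by simp
      commutes' := fun r => by
        ext i j; fin_cases i <;> fin_cases j <;> simp [Matrix.algebraMap_matrix_apply] }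
  let r : Matrix (Fin 2) (Fin 2) L := !![0, algebraMap k L a; 1, 0]
  have hr : r * r = algebraMap k _ a.val := by
    ext i j; fin_cases i <;> fin_cases j <;> simp [r, Matrix.algebraMap_matrix_apply, Algebra.smul_def]
  have hg : ∀ x, g x = !![x, 0; 0, σ x] := fun _ => rfl
  obtain ⟨F, hF, hFu⟩ := h.exists_lift hσ g r hr
    (fun x => by
      ext i j; fin_cases i <;> fin_cases j <;>
        simp [r, hg, hσ.apply_apply, Matrix.mul_apply, mul_comm])
  have hrσ : r.map σ = r := by
    ext i j; fin_cases i <;> fin_cases j <;> simp [r]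
  refine ⟨Fin 2, inferInstance, inferInstance, F, r, ?_, ?_, fun x => ?_⟩
  · rw [h.finrank_eq, Fintype.card_fin]; norm_num
  · rw [hrσ, hr, Algebra.algebraMap_eq_smul_one]
  · obtain ⟨y, z, rfl⟩ := h.exists_eq hσ x
    have h1 : ∀ y, r * (g y).map σ = g y * r := fun y => by
      ext i j; fin_cases i <;> fin_cases j <;> 
        simp [r, hg, hσ.apply_apply, Matrix.mul_apply, mul_comm]
    rw [map_add, map_mul, hF, hF, hFu, Matrix.map_add _ (map_add σ), Matrix.map_mul, hrσ, mul_add,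
      h1, ← mul_assoc, h1, add_mul]

end Descent

/-! ### Descent data of algebras split by a quadratic extension -/

section SplitDescent

/-- The Skolem–Noether theorem for matrix algebras, carried over from endomorphism algebras. -/
theorem Matrix.exists_conj_of_algEquiv {L : Type v} [Field L] {ι : Type w} [Fintype ι]
    [DecidableEq ι] (Ψ : Matrix ι ι L ≃ₐ[L] Matrix ι ι L) :
    ∃ P : (Matrix ι ι L)ˣ, ∀ M, Ψ M * P = P * M := by
  let e : Matrix ι ι L ≃ₐ[L] Module.End L (ι → L) := Matrix.toLinAlgEquiv'
  obtain ⟨T, hT⟩ := ((e.symm.trans Ψ).trans e).eq_linearEquivConjAlgEquiv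
  let U : (Module.End L (ι → L))ˣ :=
    ⟨T, T.symm, LinearMap.ext T.apply_symm_apply, LinearMap.ext T.symm_apply_apply⟩
  refine ⟨Units.map e.symm.toAlgHom.toMonoidHom U, fun M => ?_⟩
  change Ψ M * e.symm T.toLinearMap = e.symm T.toLinearMap * M
  apply e.injective
  rw [map_mul, map_mul, e.apply_symm_apply]
  have h := DFunLike.congr_fun hT (e M)
  rw [AlgEquiv.trans_apply, AlgEquiv.trans_apply, e.symm_apply_apply,
    LinearEquiv.conjAlgEquiv_apply] at h
  rw [h]
  refine LinearMap.ext fun v => ?_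
  simp

variable {k : Type u} {L : Type v} [Field k] [Field L] [Algebra k L]

/-- The involution `σ ⊗ 1` of `L ⊗ A` becomes a semilinear involution `α` of the matrix algebra.
Composed with the entrywise `σ` it is `L`-linear, hence conjugation by some `P`. As `α` fixes the
image of `A`, that image satisfies the descent equation. -/
theorem CSA.SplitBy.exists_hasDescentDatum {A : CSA.{u, u} k} (hA : A.SplitBy L) {σ : Gal(L/k)}
    (hσ : IsQuadraticConj σ) : ∃ c : kˣ, A.HasDescentDatum σ c := by
  obtain ⟨n, ⟨φ⟩⟩ := hA
  have hdim : Module.finrank k A = n ^ 2 := by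
    have := φ.toLinearEquiv.finrank_eq
    rwa [Module.finrank_baseChange, Module.finrank_matrix, Module.finrank_self, Fintype.card_fin,
      mul_one, ← sq] at this
  have hn : n ≠ 0 := by
    rintro rfl
    exact (Module.finrank_pos (R := k) (M := A)).ne' hdim
  have : NeZero n := ⟨hn⟩
  let s : L ⊗[k] A ≃ₐ[k] L ⊗[k] A := Algebra.TensorProduct.congr σ AlgEquiv.refl
  have hs : ∀ l x, s (l ⊗ₜ x) = σ l ⊗ₜ x := fun _ _ => rfl
  have hss : ∀ x, s (s x) = x := fun x => by
    induction x using TensorProduct.induction_on with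
    | zero => simp
    | add x y hx hy => rw [map_add, map_add, hx, hy]
    | tmul x y => rw [hs, hs, hσ.apply_apply]
  let α : Matrix (Fin n) (Fin n) L ≃ₐ[k] Matrix (Fin n) (Fin n) L :=
    ((φ.restrictScalars k).symm.trans s).trans (φ.restrictScalars k)
  have hα : ∀ M, α M = φ (s (φ.symm M)) := fun _ => rfl
  have hαα : ∀ M, α (α M) = M := fun M => by
    rw [hα, hα, φ.symm_apply_apply, hss, φ.apply_symm_apply]
  have hmm : ∀ M : Matrix (Fin n) (Fin n) L, (M.map σ).map σ = M := fun M => by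
    ext; simp [hσ.apply_apply]
  let Ψ : Matrix (Fin n) (Fin n) L ≃ₐ[L] Matrix (Fin n) (Fin n) L :=
    AlgEquiv.ofRingEquiv (f := (σ.mapMatrix.trans α).toRingEquiv) fun l => by
      change α ((algebraMap L (Matrix (Fin n) (Fin n) L) l).map σ) = _
      have h1 : (algebraMap L (Matrix (Fin n) (Fin n) L) l).map σ = algebraMap L _ (σ l) := by
        ext i j
        rw [Matrix.map_apply, Matrix.algebraMap_matrix_apply, Matrix.algebraMap_matrix_apply]
        split_ifs <;> simp
      rw [h1, hα, AlgEquiv.commutes, Algebra.TensorProduct.algebraMap_apply, hs]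
      change φ (σ (σ l) ⊗ₜ 1) = _
      rw [hσ.apply_apply]
      exact φ.commutes l
  have hΨ : ∀ M, Ψ M = α (M.map σ) := fun _ => rfl
  obtain ⟨P, hP⟩ := Matrix.exists_conj_of_algEquiv Ψ
  have hP' : ∀ M, α M * P = P * M.map σ := fun M => by
    rw [← hP, hΨ, hmm]
  -- From `α² = 1`: conjugation by `P σ(P)` is trivial, so `P σ(P)` is a scalar.
  have hcomm : ∀ M, Commute (P.val * P.val.map σ) M := fun M => by
    have h1 : M * P.val * P.val.map σ = P.val * (α M * P.val).map σ := by
      conv_lhs => rw [← hαα M, hP', mul_assoc, ← Matrix.map_mul]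
    rw [hP', Matrix.map_mul, hmm] at h1
    rw [commute_iff_eq, ← mul_assoc M, h1, mul_assoc]
  obtain ⟨c, hc⟩ := Matrix.mem_range_scalar_of_commute_single
    (M := P.val * P.val.map σ) fun i j _ => (hcomm _).symm
  -- Applying `σ` to `P σ(P)` gives `σ(P) P`, which is the same matrix because `P` commutes with `P
  -- σ(P)` and can be cancelled.
  have hσc : σ c = c := by
    have h1 : (P.val * P.val.map σ).map σ = P.val * P.val.map σ := by
      have h2 : P.val.map σ * P.val = P.val * P.val.map σ :=
        (P.isUnit.mul_right_injective (by
          change P.val * (P.val.map σ * P.val) = P.val * (P.val * P.val.map σ)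
          rw [← mul_assoc]; exact hcomm _))
      rw [Matrix.map_mul, hmm, h2]
    rw [← hc] at h1
    simpa using congrFun (congrFun h1 0) 0
  have hPu : IsUnit (P.val * P.val.map σ) :=
    P.isUnit.mul (P.isUnit.map σ.mapMatrix)
  have hc0 : c ≠ 0 := by
    rintro rfl
    rw [← hc, map_zero] at hPu
    exact not_isUnit_zero hPu
  obtain ⟨d, rfl⟩ := hσ.mem_of_fixed c hσc
  have hd : d ≠ 0 := by
    rintro rfl
    exact hc0 (map_zero _)
  let f : A →ₐ[k] Matrix (Fin n) (Fin n) L :=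
    (φ.restrictScalars k).toAlgHom.comp Algebra.TensorProduct.includeRight
  have hf : ∀ x, f x = φ (1 ⊗ₜ x) := fun _ => rfl
  refine ⟨Units.mk0 d hd, Fin n, inferInstance, inferInstance, f, P, ?_, ?_, fun x => ?_⟩
  · rw [hdim, Fintype.card_fin]
  · rw [← hc]
    ext i j
    simp [Matrix.scalar_apply, Matrix.diagonal_apply, Matrix.one_apply, Algebra.smul_def]
  · rw [← hP', hα, hf, φ.symm_apply_apply, hs, map_one]

end SplitDescent

/-! ### Cyclic algebras of a quadratic extension -/

section QuadraticCyclic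

variable {k : Type u} {L : Type v} [Field k] [Field L] [Algebra k L]

theorem IsQuadraticCyclic.map {B C : Type*} [Ring B] [Ring C] [Algebra k B] [Algebra k C]
    {σ : Gal(L/k)} {a : kˣ} {f : L →ₐ[k] B} {u : B} (h : IsQuadraticCyclic σ a f u)
    (e : B ≃ₐ[k] C) : IsQuadraticCyclic σ a (e.toAlgHom.comp f) (e u) where
  finrank_eq := by rw [← e.toLinearEquiv.finrank_eq, h.finrank_eq]
  mul_self := by rw [← map_mul, h.mul_self, AlgEquiv.commutes]
  mul_map x := by
    change e u * e (f x) = e (f (σ x)) * e u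
    rw [← map_mul, h.mul_map, map_mul]

/-- The `2 × 2` matrices with rows `(x, a σ(y))` and `(y, σ(x))`. -/
def quadraticCyclicSubalgebra (σ : Gal(L/k)) (hσ : ∀ x, σ (σ x) = x) (a : k) :
    Subalgebra k (Matrix (Fin 2) (Fin 2) L) where
  carrier := {M | M 0 1 = a • σ (M 1 0) ∧ M 1 1 = σ (M 0 0)}
  mul_mem' := by
    rintro M N ⟨h1, h2⟩ ⟨h3, h4⟩
    simp only [Set.mem_ofPred_eq, Matrix.mul_apply, Fin.sum_univ_two, h1, h2, h3, h4, map_add,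
      map_mul, hσ, Algebra.smul_def, AlgEquiv.commutes]
    constructor <;> ring
  add_mem' := by
    rintro M N ⟨h1, h2⟩ ⟨h3, h4⟩
    simp [h1, h2, h3, h4]
  algebraMap_mem' r := by simp [Matrix.algebraMap_matrix_apply]

theorem quadraticCyclicSubalgebra.isQuadraticCyclic {σ : Gal(L/k)} (hσ : IsQuadraticConj σ)
    (a : kˣ) : ∃ (f : L →ₐ[k] quadraticCyclicSubalgebra σ hσ.apply_apply a.val)
      (u : quadraticCyclicSubalgebra σ hσ.apply_apply a.val), IsQuadraticCyclic σ a f u := by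
  have hL : FiniteDimensional k L := FiniteDimensional.of_finrank_pos (by rw [hσ.finrank_eq]; simp)
  let S := quadraticCyclicSubalgebra σ hσ.apply_apply a.val
  -- The first column is arbitrary and determines the second.
  let e : S ≃ₗ[k] L × L :=
    { toFun := fun M => (M.1 0 0, M.1 1 0)
      map_add' := fun _ _ => rfl
      map_smul' := fun _ _ => rfl
      invFun := fun x => ⟨!![x.1, a.val • σ x.2; x.2, σ x.1], by
        constructor <;> simp⟩
      left_inv := fun M => by
        obtain ⟨M, h1, h2⟩ := M
        ext i j
        fin_cases i <;> fin_cases j <;> simp [h1, h2]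
      right_inv := fun x => by simp }
  let f : L →ₐ[k] S :=
    { toFun := fun x => ⟨!![x, 0; 0, σ x], by constructor <;> simp⟩
      map_one' := Subtype.ext (by simp [Matrix.one_fin_two])
      map_mul' := fun x y => Subtype.ext (by simp)
      map_zero' := Subtype.ext (by ext i j; fin_cases i <;> fin_cases j <;> simp)
      map_add' := fun x y => Subtype.ext (by simp)
      commutes' := fun r => Subtype.ext (by
        ext i j; fin_cases i <;> fin_cases j <;> simp [Matrix.algebraMap_matrix_apply]) }
  let u : S := ⟨!![0, algebraMap k L a; 1, 0], by
    constructor <;> simp [Algebra.algebraMap_eq_smul_one]⟩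
  refine ⟨f, u, ⟨?_, Subtype.ext ?_, fun x => Subtype.ext ?_⟩⟩
  · rw [e.finrank_eq, Module.finrank_prod, hσ.finrank_eq]
  · change !![0, algebraMap k L a; 1, 0] * !![0, algebraMap k L a; 1, 0] = algebraMap k _ a.val
    ext i j; fin_cases i <;> fin_cases j <;>
      simp [Matrix.algebraMap_matrix_apply, Algebra.smul_def]
  · change !![0, algebraMap k L a; 1, 0] * !![x, 0; 0, σ x] =
      !![σ x, 0; 0, σ (σ x)] * !![0, algebraMap k L a; 1, 0]
    ext i j; fin_cases i <;> fin_cases j <;>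
      simp [Matrix.mul_apply, hσ.apply_apply, mul_comm]

theorem CSA.exists_isCyclicAlgebra {σ : Gal(L/k)} (hσ : IsQuadraticConj σ) (a : kˣ) :
    ∃ A : CSA.{u, u} k, A.IsCyclicAlgebra σ a := by
  obtain ⟨f, u, h⟩ := quadraticCyclicSubalgebra.isQuadraticCyclic hσ a
  let S := quadraticCyclicSubalgebra σ hσ.apply_apply a.val
  have : FiniteDimensional k S := FiniteDimensional.of_finrank_pos (by rw [h.finrank_eq]; simp)
  -- The matrices live in the universe of `L`; finite dimension over `k` brings a copy of the
  -- algebra into the universe of `k`.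
  have : Small.{u} S := small_of_injective (Module.finBasis k S).equivFun.injective
  have h' := h.map (Shrink.algEquiv k S).symm
  have := h'.isSimpleRing hσ
  have := h'.isCentral hσ
  have : FiniteDimensional k (Shrink.{u} S) :=
    FiniteDimensional.of_finrank_pos (by rw [h'.finrank_eq]; simp)
  exact ⟨CSA.ofAlgebra k (Shrink.{u} S),
    (CSA.IsCyclicAlgebra.iff_of_isQuadraticConj hσ).2 ⟨_, _, h'⟩⟩

variable {σ : Gal(L/k)} {a b c : kˣ} {A B C : CSA.{u, u} k}

theorem CSA.IsCyclicAlgebra.brauerClass_mul_self (hσ : IsQuadraticConj σ)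
    (hA : A.IsCyclicAlgebra σ a) : A.brauerClass * A.brauerClass = 1 :=
  (hA.hasDescentDatum hσ).brauerClass_mul hσ hA

/-- The classes of `A` and of `B` are both inverse to that of `B`. -/
theorem CSA.HasDescentDatum.brauerClass_eq (hσ : IsQuadraticConj σ)
    (hA : A.HasDescentDatum σ a) (hB : B.IsCyclicAlgebra σ a) : A.brauerClass = B.brauerClass :=
  mul_right_cancel ((hA.brauerClass_mul hσ hB).trans (hB.brauerClass_mul_self hσ).symm)

theorem CSA.IsCyclicAlgebra.brauerClass_mul (hσ : IsQuadraticConj σ)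
    (hA : A.IsCyclicAlgebra σ a) (hB : B.IsCyclicAlgebra σ b) (hC : C.IsCyclicAlgebra σ (a * b)) :
    C.brauerClass = A.brauerClass * B.brauerClass :=
  (((hA.hasDescentDatum hσ).tensor (hB.hasDescentDatum hσ)).brauerClass_eq hσ hC).symm

/-- A trivial class gives an action on a plane `V` over `k`, which is a line `L w`. Writing `u w = t
w` and applying `u` again yields `a = t σ(t)`. Conversely, if `a = t σ(t)`, then `u` can act on `L`
as `v ↦ t σ(v)`. -/
theorem CSA.IsCyclicAlgebra.brauerClass_eq_one_iff (hσ : IsQuadraticConj σ)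
    (hA : A.IsCyclicAlgebra σ a) : A.brauerClass = 1 ↔ ∃ t : L, a = Algebra.norm k t := by
  have hL : FiniteDimensional k L := FiniteDimensional.of_finrank_pos (by rw [hσ.finrank_eq]; simp)
  obtain ⟨f, u, h⟩ := (CSA.IsCyclicAlgebra.iff_of_isQuadraticConj hσ).1 hA
  constructor
  · intro h1
    obtain ⟨V, _, _, ρ, hV⟩ := CSA.exists_action_of_brauerClass_eq_one h1
    have hV2 : Module.finrank k V = 2 := by
      rw [h.finrank_eq] at hV
      nlinarith
    have : FiniteDimensional k V := FiniteDimensional.of_finrank_pos (by rw [hV2]; simp)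
    have : Nontrivial V := Module.nontrivial_of_finrank_pos (R := k) (by rw [hV2]; simp)
    obtain ⟨w, hw⟩ := exists_ne (0 : V)
    let F : L →ₗ[k] V := (LinearMap.applyₗ w).comp (ρ.comp f).toLinearMap
    have hF : ∀ x, F x = ρ (f x) w := fun _ => rfl
    have hF0 : ∀ x, F x = 0 → x = 0 := fun x hx => by
      by_contra hx0
      apply hw
      have h2 : ρ (f x⁻¹) (ρ (f x) w) = w := by
        rw [← Module.End.mul_apply, ← map_mul, ← map_mul, inv_mul_cancel₀ hx0, map_one, map_one,
          Module.End.one_apply]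
      rw [← h2, ← hF, hx, map_zero]
    have hFi : Function.Injective F := (injective_iff_map_eq_zero F).2 hF0
    obtain ⟨t, ht⟩ := (LinearMap.injective_iff_surjective_of_finrank_eq_finrank
      (by rw [hV2, hσ.finrank_eq])).1 hFi (ρ u w)
    refine ⟨t, (algebraMap k L).injective ?_⟩
    rw [hσ.norm_eq]
    apply hFi
    have h3 : ρ u (F t) = F (t * σ t) := by
      rw [hF, ← Module.End.mul_apply, ← map_mul, h.mul_map, map_mul, Module.End.mul_apply, ← ht, hF,
        hF, ← Module.End.mul_apply, ← map_mul, ← map_mul, mul_comm t]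
    rw [← h3, ht, ← Module.End.mul_apply, ← map_mul, h.mul_self, hF, f.commutes]
  · rintro ⟨t, ht⟩
    let T : Module.End k L := LinearMap.mulLeft k t * σ.toLinearMap
    have hT : ∀ v, T v = t * σ v := fun _ => rfl
    obtain ⟨F, -, -⟩ := h.exists_lift hσ (Algebra.lmul k L) T
      (LinearMap.ext fun v => by
        rw [Module.End.mul_apply, hT, hT, map_mul, hσ.apply_apply, ← mul_assoc, ← hσ.norm_eq, ← ht,
          ← Algebra.smul_def]
        rfl)
      (fun x => LinearMap.ext fun v => by
        simp [hT, mul_left_comm])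
    have h1 := A.brauerClass_mul_eq_one_of_commute (CSA.ofAlgebra k k) F (Algebra.ofId k _)
      (fun x y => (Algebra.commutes y (F x)).symm) (by
        rw [h.finrank_eq, hσ.finrank_eq]
        change 4 * Module.finrank k k = _
        rw [Module.finrank_self]
        norm_num)
    rwa [CSA.brauerClass_self, mul_one] at h1

/-- The homomorphism from `kˣ` to the relative Brauer group of a quadratic Galois extension
given by cyclic algebras: it is onto, and its kernel consists of the norms. -/
theorem exists_cyclicAlgebraHom_of_isQuadraticConj (hσ : IsQuadraticConj σ) :
    ∃ β : kˣ →* relativeBrauerGroup k L, Function.Surjective β ∧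
      (∀ a, β a = 1 ↔ ∃ t : L, (a : k) = Algebra.norm k t) ∧
      ∀ a : kˣ, ∃ A : CSA.{u, u} k, A.IsCyclicAlgebra σ a ∧
        (β a : BrauerGroup.{u, u} k) = Quotient.mk _ A := by
  choose A hA using CSA.exists_isCyclicAlgebra (k := k) hσ
  let β : kˣ →* relativeBrauerGroup k L :=
    MonoidHom.mk' (fun a => ⟨(A a).brauerClass, A a, ((hA a).hasDescentDatum hσ).splitBy, rfl⟩)
      fun a b => Subtype.ext ((hA a).brauerClass_mul hσ (hA b) (hA (a * b)))
  refine ⟨β, ?_, fun a => ?_, fun a => ⟨A a, hA a, rfl⟩⟩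
  · rintro ⟨_, B, hB, rfl⟩
    obtain ⟨c, hc⟩ := hB.exists_hasDescentDatum hσ
    exact ⟨c, Subtype.ext (hc.brauerClass_eq hσ (hA c)).symm⟩
  · rw [← (hA a).brauerClass_eq_one_iff hσ, Subtype.ext_iff]
    rfl

/-- Here `L = k`: the relative Brauer group is trivial, the norm is the identity, and `k` with `u =
a` is the cyclic algebra. -/
theorem exists_cyclicAlgebraHom_of_finrank_eq_one (h : Module.finrank k L = 1) :
    ∃ β : kˣ →* relativeBrauerGroup k L, Function.Surjective β ∧
      (∀ a, β a = 1 ↔ ∃ t : L, (a : k) = Algebra.norm k t) ∧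
      ∀ (a : kˣ) (σ : Gal(L/k)), ∃ A : CSA.{u, u} k, A.IsCyclicAlgebra σ a ∧
        (β a : BrauerGroup.{u, u} k) = Quotient.mk _ A := by
  have hL : FiniteDimensional k L := FiniteDimensional.of_finrank_pos (by rw [h]; simp)
  have hbij : Function.Bijective (algebraMap k L) := by
    refine ⟨(algebraMap k L).injective, ?_⟩
    exact (LinearMap.injective_iff_surjective_of_finrank_eq_finrank
      (f := Algebra.linearMap k L) (by rw [h, Module.finrank_self])).1 (algebraMap k L).injective
  let e : k ≃ₐ[k] L := AlgEquiv.ofBijective (Algebra.ofId k L) hbij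
  refine ⟨1, ?_, fun a => ?_, fun a σ => ⟨CSA.ofAlgebra k k, ⟨?_, e.symm.toAlgHom, a.val, ?_, ?_⟩,
    rfl⟩⟩
  · rintro ⟨_, B, ⟨n, ⟨φ⟩⟩, rfl⟩
    refine ⟨1, Subtype.ext ?_⟩
    change 1 = B.brauerClass
    rw [← CSA.brauerClass_self, eq_comm, CSA.brauerClass_eq_iff]
    let ψ : B ≃ₐ[k] Matrix (Fin n) (Fin n) k :=
      ((Algebra.TensorProduct.lid k B).symm.trans
        (Algebra.TensorProduct.congr e AlgEquiv.refl)).trans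
        ((φ.restrictScalars k).trans e.symm.mapMatrix)
    refine .of_matrix (n := n) ?_ ψ
    rintro rfl
    have := ψ.toLinearEquiv.finrank_eq
    rw [Module.finrank_matrix] at this
    exact (Module.finrank_pos (R := k) (M := B)).ne' (by simpa using this)
  · refine ⟨fun _ => ⟨algebraMap k L a, ?_⟩, fun _ => rfl⟩
    rw [Algebra.norm_algebraMap, h, pow_one]
  · rw [h]
    exact Module.finrank_self k
  · rw [h, pow_one]
    rfl
  · intro x
    obtain ⟨y, rfl⟩ := hbij.2 x
    rw [σ.commutes]
    exact mul_comm (a.val) (e.symm (algebraMap k L y))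

theorem exists_cyclicAlgebraHom [IsGalois k L]
    (h : Module.finrank k L = 1 ∨ Module.finrank k L = 2) :
    ∃ β : kˣ →* relativeBrauerGroup k L, Function.Surjective β ∧
      (∀ a, β a = 1 ↔ ∃ t : L, (a : k) = Algebra.norm k t) ∧
      ∀ (a : kˣ) (σ : Gal(L/k)), (∀ τ, τ ∈ Subgroup.zpowers σ) →
        ∃ A : CSA.{u, u} k, A.IsCyclicAlgebra σ a ∧
          (β a : BrauerGroup.{u, u} k) = Quotient.mk _ A := by
  obtain h | h := h
  · obtain ⟨β, h1, h2, h3⟩ := exists_cyclicAlgebraHom_of_finrank_eq_one h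
    exact ⟨β, h1, h2, fun a σ _ => h3 a σ⟩
  · have hL : FiniteDimensional k L := FiniteDimensional.of_finrank_pos (by rw [h]; simp)
    have hcard : Nat.card Gal(L/k) = 2 := by rw [IsGalois.card_aut_eq_finrank, h]
    obtain ⟨σ₀, hσ₀, huniq⟩ := (Nat.card_eq_two_iff' (1 : Gal(L/k))).1 hcard
    obtain ⟨β, h1, h2, h3⟩ :=
      exists_cyclicAlgebraHom_of_isQuadraticConj (IsQuadraticConj.of_ne_one h hσ₀)
    refine ⟨β, h1, h2, fun a σ hσ => ?_⟩
    -- A group of order two has only one generator, so `β` built from `σ₀` serves every `σ` allowed.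
    have : σ = σ₀ := huniq σ fun h1 => hσ₀ <| by simpa [h1] using hσ σ₀
    rw [this]
    exact h3 a

end QuadraticCyclic

/-! ### The first cohomology of `U ⊗ Kˣ` -/

section Canonical

variable {G : Type u} [Group G] {U : Representation ℤ G ℤ}

theorem mem_canonicalSubgroup {g : G} : g ∈ canonicalSubgroup U ↔ U g 1 = 1 := Iff.rfl

theorem representation_int_apply (g : G) (n : ℤ) : U g n = n * U g 1 := by
  have := (U g).map_smul n 1
  rwa [smul_eq_mul, mul_one, smul_eq_mul] at this

theorem mul_mem_canonicalSubgroup_of_notMem {g h : G} (hg : g ∉ canonicalSubgroup U)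
    (hh : h ∉ canonicalSubgroup U) : g * h ∈ canonicalSubgroup U := by
  rw [mem_canonicalSubgroup, map_mul, Module.End.mul_apply, representation_int_apply,
    apply_one_of_notMem hg, apply_one_of_notMem hh]
  norm_num

theorem inv_mul_mem_canonicalSubgroup_of_notMem {g h : G} (hg : g ∉ canonicalSubgroup U)
    (hh : h ∉ canonicalSubgroup U) : g⁻¹ * h ∈ canonicalSubgroup U :=
  mul_mem_canonicalSubgroup_of_notMem (fun h1 => hg (inv_mem_iff.1 h1)) hh

instance normal_canonicalSubgroup : (canonicalSubgroup U).Normal where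
  conj_mem n hn g := by
    by_cases hg : g ∈ canonicalSubgroup U
    · exact mul_mem (mul_mem hg hn) (inv_mem hg)
    · refine mul_mem_canonicalSubgroup_of_notMem (fun h => hg ?_) fun h => hg (inv_mem_iff.1 h)
      exact (Subgroup.mul_mem_cancel_right _ hn).1 h

theorem index_canonicalSubgroup {g : G} (hg : g ∉ canonicalSubgroup U) :
    (canonicalSubgroup U).index = 2 := by
  rw [Subgroup.index_eq_two_iff]
  refine ⟨g, fun b => ?_⟩
  by_cases hb : b ∈ canonicalSubgroup U
  · exact .inr ⟨hb, fun h => hg ((Subgroup.mul_mem_cancel_left _ hb).1 h)⟩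
  · exact .inl ⟨mul_mem_canonicalSubgroup_of_notMem hb hg, hb⟩

end Canonical

/-! ### Cocycles and coboundaries as functions into `Kˣ` with the twisted action -/

section TwistedUnits

variable {k : Type u} {K : Type v} [Field k] [Field K] [Algebra k K]
  (U : Representation ℤ Gal(K/k) ℤ)

/-- The identification of `U ⊗ Kˣ` with `Kˣ` as a group. -/
noncomputable def twistedUnitsEquiv (K : Type v) [Field K] :
    TensorProduct ℤ ℤ (Additive Kˣ) ≃+ Additive Kˣ :=
  (TensorProduct.lid ℤ (Additive Kˣ)).toAddEquiv

theorem twistedUnitsEquiv_oneTmulUnit (a : kˣ) :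
    (twistedUnitsEquiv K (oneTmulUnit K a)).toMul = Units.map (algebraMap k K : k →* K) a :=
  one_zsmul (Additive.ofMul (Units.map (algebraMap k K : k →* K) a))

theorem twistedUnitsEquiv_apply (g : Gal(K/k)) (x : TensorProduct ℤ ℤ (Additive Kˣ)) :
    (twistedUnitsEquiv K (twistedUnits U g x)).toMul =
      (g • (twistedUnitsEquiv K x).toMul) ^ (U g 1) := by
  induction x using TensorProduct.induction_on with
  | zero => simp
  | add x y hx hy =>
    rw [map_add (twistedUnits U g), map_add (twistedUnitsEquiv K), map_add (twistedUnitsEquiv K),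
      toMul_add, toMul_add, hx, hy, smul_mul', mul_zpow]
  | tmul n x =>
    rw [twistedUnits, Representation.tprod_apply, TensorProduct.map_tmul,
      Representation.ofMulDistribMulAction_apply_apply, representation_int_apply]
    change (g • x.toMul) ^ (n * U g 1) = (g • (x.toMul ^ n)) ^ U g 1
    rw [zpow_mul, smul_zpow']

variable {U}

theorem twistedUnitsEquiv_apply_of_mem {g : Gal(K/k)} (hg : g ∈ canonicalSubgroup U)
    (x : TensorProduct ℤ ℤ (Additive Kˣ)) :
    (twistedUnitsEquiv K (twistedUnits U g x)).toMul = g • (twistedUnitsEquiv K x).toMul := by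
  rw [twistedUnitsEquiv_apply, mem_canonicalSubgroup.1 hg, zpow_one]

theorem twistedUnitsEquiv_apply_of_notMem {g : Gal(K/k)} (hg : g ∉ canonicalSubgroup U)
    (x : TensorProduct ℤ ℤ (Additive Kˣ)) :
    (twistedUnitsEquiv K (twistedUnits U g x)).toMul = (g • (twistedUnitsEquiv K x).toMul)⁻¹ := by
  rw [twistedUnitsEquiv_apply, apply_one_of_notMem hg, zpow_neg_one]

theorem stepCocycle_apply_of_mem {g : Gal(K/k)} (hg : g ∈ canonicalSubgroup U) (a : kˣ) :
    (stepCocycle U a).1 g = 0 :=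
  if_pos hg

theorem stepCocycle_apply_of_notMem {g : Gal(K/k)} (hg : g ∉ canonicalSubgroup U) (a : kˣ) :
    (stepCocycle U a).1 g = oneTmulUnit K a :=
  if_neg hg

variable (U)

theorem stepCocycle_mul (a b : kˣ) : stepCocycle U (a * b) = stepCocycle U a + stepCocycle U b := by
  refine Subtype.ext (funext fun g => ?_)
  rw [AddSubgroup.coe_add, Pi.add_apply]
  by_cases hg : g ∈ canonicalSubgroup U
  · simp only [stepCocycle_apply_of_mem hg, add_zero]
  · simp only [stepCocycle_apply_of_notMem hg]
    rw [oneTmulUnit, map_mul, ofMul_mul, TensorProduct.tmul_add]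
    rfl

/-- The homomorphism `a ↦ stepClass U a`. -/
noncomputable def stepHom : kˣ →* Multiplicative (FirstCohomology (twistedUnits U)) :=
  MonoidHom.mk' (fun a => .ofAdd (stepClass U a)) fun a b => by
    rw [stepClass, stepCocycle_mul]
    rfl

/-- The coboundary of an element of `U ⊗ Kˣ`. -/
noncomputable def twistedCoboundary (x : TensorProduct ℤ ℤ (Additive Kˣ)) :
    oneCocycles (twistedUnits U) :=
  ⟨fun g => twistedUnits U g x - x, fun g h => by
    simp only [map_mul, Module.End.mul_apply, map_sub]
    abel⟩

theorem twistedCoboundary_mem (x : TensorProduct ℤ ℤ (Additive Kˣ)) :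
    twistedCoboundary U x ∈ oneCoboundaries (twistedUnits U) :=
  ⟨x, fun _ => rfl⟩

/-- In `Kˣ`, the coboundary of `v = x⁻¹` takes the value `(g v)⁻¹ / v = x * g x` outside the
canonical subgroup, and `g v / v` inside it. -/
theorem stepCocycle_mem_oneCoboundaries_iff (a : kˣ) :
    stepCocycle U a ∈ oneCoboundaries (twistedUnits U) ↔
      ∃ x : Kˣ, (∀ g ∈ canonicalSubgroup U, g • x = x) ∧
        ∀ g ∉ canonicalSubgroup U, Units.map (algebraMap k K : k →* K) a = x * g • x := by
  constructor
  · rintro ⟨v, hv⟩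
    have hv' : ∀ g, (twistedUnitsEquiv K ((stepCocycle U a).1 g)).toMul =
        (twistedUnitsEquiv K (twistedUnits U g v)).toMul / (twistedUnitsEquiv K v).toMul :=
      fun g => by rw [hv g, map_sub, toMul_sub]
    refine ⟨(twistedUnitsEquiv K v).toMul⁻¹, fun g hg => ?_, fun g hg => ?_⟩
    · have h := hv' g
      rw [stepCocycle_apply_of_mem hg, map_zero, toMul_zero, twistedUnitsEquiv_apply_of_mem hg,
        eq_comm, div_eq_one] at h
      rw [smul_inv', h]
    · have h := hv' g
      rw [stepCocycle_apply_of_notMem hg, twistedUnitsEquiv_oneTmulUnit,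
        twistedUnitsEquiv_apply_of_notMem hg] at h
      rw [h, smul_inv', div_eq_mul_inv, mul_comm]
  · rintro ⟨x, hx, hx'⟩
    refine ⟨(twistedUnitsEquiv K).symm (.ofMul x⁻¹), fun g => ?_⟩
    apply (twistedUnitsEquiv K).injective
    apply Additive.toMul.injective
    rw [map_sub, toMul_sub]
    by_cases hg : g ∈ canonicalSubgroup U
    · rw [stepCocycle_apply_of_mem hg, twistedUnitsEquiv_apply_of_mem hg, AddEquiv.apply_symm_apply,
        toMul_ofMul, smul_inv', hx g hg, div_self', map_zero, toMul_zero]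
    · rw [stepCocycle_apply_of_notMem hg, twistedUnitsEquiv_apply_of_notMem hg,
        AddEquiv.apply_symm_apply, toMul_ofMul, smul_inv', inv_inv, div_inv_eq_mul,
        twistedUnitsEquiv_oneTmulUnit, hx' g hg, mul_comm]

variable [FiniteDimensional k K]

/-- On the canonical subgroup, which is `Gal(K/L)`, the twisted action is the ordinary one, so
Hilbert 90 for `K/L` applies. -/
theorem exists_smul_div_eq_of_oneCocycle (c : oneCocycles (twistedUnits U)) :
    ∃ x : Kˣ, ∀ g ∈ canonicalSubgroup U, g • x / x = (twistedUnitsEquiv K (c.1 g)).toMul := by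
  let L : IntermediateField k K := IntermediateField.fixedField (canonicalSubgroup U)
  have hL : L.fixingSubgroup = canonicalSubgroup U := IntermediateField.fixingSubgroup_fixedField _
  have hmem : ∀ τ : Gal(K/L), τ.restrictScalars k ∈ canonicalSubgroup U := fun τ => by
    rw [← hL]
    exact (IntermediateField.fixingSubgroupEquiv L |>.symm τ).2
  obtain ⟨x, hx⟩ := groupCohomology.isMulCoboundary₁_of_isMulCocycle₁_of_aut_to_units
    (K := L) (L := K) (fun τ => (twistedUnitsEquiv K (c.1 (τ.restrictScalars k))).toMul)
    (fun σ τ => by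
      have h1 := c.2 (σ.restrictScalars k) (τ.restrictScalars k)
      have h2 : (σ * τ).restrictScalars k = σ.restrictScalars k * τ.restrictScalars k := rfl
      simp only
      rw [h2, h1, map_add, toMul_add, twistedUnitsEquiv_apply_of_mem (hmem σ), mul_comm]
      rfl)
  refine ⟨x, fun g hg => ?_⟩
  rw [← hL] at hg
  exact hx (IntermediateField.fixingSubgroupEquiv L ⟨g, hg⟩)

variable [IsGalois k K]

theorem stepClass_surjective (z : FirstCohomology (twistedUnits U)) :
    ∃ a : kˣ, z = stepClass U a := by
  obtain ⟨c, rfl⟩ := QuotientAddGroup.mk_surjective z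
  obtain ⟨x, hx⟩ := exists_smul_div_eq_of_oneCocycle U c
  let v := (twistedUnitsEquiv K).symm (.ofMul x)
  have hv : (twistedUnitsEquiv K v).toMul = x := by simp [v]
  -- A cohomologous cocycle, trivial on the canonical subgroup.
  let d : oneCocycles (twistedUnits U) := c - twistedCoboundary U v
  have hd : ∀ g ∈ canonicalSubgroup U, d.1 g = 0 := fun g hg => by
    apply (twistedUnitsEquiv K).injective
    apply Additive.toMul.injective
    change (twistedUnitsEquiv K (c.1 g - (twistedUnits U g v - v))).toMul = _
    rw [map_sub (twistedUnitsEquiv K), toMul_sub, map_sub (twistedUnitsEquiv K), toMul_sub,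
      twistedUnitsEquiv_apply_of_mem hg, hv, hx g hg, div_self', map_zero, toMul_zero]
  suffices h : ∃ a : kˣ, ∀ g ∉ canonicalSubgroup U, d.1 g = oneTmulUnit K a by
    obtain ⟨a, ha⟩ := h
    have hda : d = stepCocycle U a := by
      refine Subtype.ext (funext fun g => ?_)
      by_cases hg : g ∈ canonicalSubgroup U
      · rw [hd g hg, stepCocycle_apply_of_mem hg]
      · rw [ha g hg, stepCocycle_apply_of_notMem hg]
    refine ⟨a, ?_⟩
    rw [stepClass, ← hda, QuotientAddGroup.eq]
    have : -c + d = -twistedCoboundary U v := by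
      simp only [d]
      abel
    rw [this]
    exact neg_mem (twistedCoboundary_mem U v)
  by_cases hI : ∃ g₀, g₀ ∉ canonicalSubgroup U
  swap
  · push Not at hI
    exact ⟨1, fun g hg => absurd (hI g) hg⟩
  obtain ⟨g₀, hg₀⟩ := hI
  have hconst : ∀ g ∉ canonicalSubgroup U, d.1 g = d.1 g₀ := fun g hg => by
    have h1 := d.2 g₀ (g₀⁻¹ * g)
    rwa [mul_inv_cancel_left, hd _ (inv_mul_mem_canonicalSubgroup_of_notMem hg₀ hg), map_zero,
      add_zero] at h1
  let y : Kˣ := (twistedUnitsEquiv K (d.1 g₀)).toMul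
  -- For `g` in the canonical subgroup, compare `d (g g₀)` with `d g₀`. For `g` outside it, `g g`
  -- lies inside, and `0 = d (g g)` reads `1 = y * (g y)⁻¹`.
  have hfix : ∀ g : Gal(K/k), g • y = y := fun g => by
    by_cases hg : g ∈ canonicalSubgroup U
    · have h1 := d.2 g g₀
      rw [hd g hg, zero_add, hconst (g * g₀) fun h => hg₀ ((Subgroup.mul_mem_cancel_left _ hg).1 h)]
        at h1
      have h2 := congrArg (fun z => (twistedUnitsEquiv K z).toMul) h1
      simp only [twistedUnitsEquiv_apply_of_mem hg] at h2
      exact h2.symm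
    · have h1 := d.2 g g
      rw [hd _ (mul_mem_canonicalSubgroup_of_notMem hg hg), hconst g hg] at h1
      have h2 := congrArg (fun z => (twistedUnitsEquiv K z).toMul) h1
      simp only [map_add, toMul_add, twistedUnitsEquiv_apply_of_notMem hg, map_zero,
        toMul_zero] at h2
      exact (mul_inv_eq_one.1 h2.symm).symm
  obtain ⟨a, ha⟩ := (IsGalois.mem_range_algebraMap_iff_fixed (F := k) y.val).2 fun g =>
    congrArg Units.val (hfix g)
  have ha0 : a ≠ 0 := by
    rintro rfl
    exact y.ne_zero (by rw [← ha, map_zero])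
  refine ⟨Units.mk0 a ha0, fun g hg => ?_⟩
  rw [hconst g hg]
  apply (twistedUnitsEquiv K).injective
  apply Additive.toMul.injective
  rw [twistedUnitsEquiv_oneTmulUnit]
  exact Units.ext ha.symm

theorem finrank_fixedField_canonicalSubgroup {g : Gal(K/k)} (hg : g ∉ canonicalSubgroup U) :
    Module.finrank k (IntermediateField.fixedField (canonicalSubgroup U)) = 2 := by
  rw [IntermediateField.finrank_eq_fixingSubgroup_index,
    IntermediateField.fixingSubgroup_fixedField, index_canonicalSubgroup hg]

theorem finrank_fixedField_canonicalSubgroup_of_forall (h : ∀ g, g ∈ canonicalSubgroup U) :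
    Module.finrank k (IntermediateField.fixedField (canonicalSubgroup U)) = 1 := by
  rw [IntermediateField.finrank_eq_fixingSubgroup_index,
    IntermediateField.fixingSubgroup_fixedField, Subgroup.index_eq_one, Subgroup.eq_top_iff']
  exact h

theorem stepHom_eq_one_iff (a : kˣ) :
    stepHom U a = 1 ↔
      ∃ t : (IntermediateField.fixedField (canonicalSubgroup U) : IntermediateField k K),
        (a : k) = Algebra.norm k t := by
  have h0 : stepHom U a = 1 ↔ stepCocycle U a ∈ oneCoboundaries (twistedUnits U) :=
    QuotientAddGroup.eq_zero_iff (stepCocycle U a)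
  rw [h0, stepCocycle_mem_oneCoboundaries_iff]
  let L : IntermediateField k K := IntermediateField.fixedField (canonicalSubgroup U)
  change _ ↔ ∃ t : L, (a : k) = Algebra.norm k t
  by_cases hI : ∃ g₀, g₀ ∉ canonicalSubgroup U
  swap
  · push Not at hI
    refine ⟨fun _ => ⟨algebraMap k L a, ?_⟩, fun _ =>
      ⟨1, fun _ _ => smul_one _, fun g hg => absurd (hI g) hg⟩⟩
    rw [Algebra.norm_algebraMap, finrank_fixedField_canonicalSubgroup_of_forall U hI, pow_one]
  obtain ⟨g₀, hg₀⟩ := hI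
  -- Now `L/k` is quadratic and `g₀` restricts to its conjugation, so the norm of `t` is `t * g₀ t`.
  have hgal : IsGalois k L := IsGalois.of_fixedField_normal_subgroup _
  let σ : Gal(L/k) := g₀.restrictNormal L
  have hσ : ∀ t : L, (σ t : K) = g₀ t := fun t => AlgEquiv.restrictNormal_commutes g₀ L t
  have hσ1 : σ ≠ 1 := fun h => hg₀ <| by
    rw [← IntermediateField.fixingSubgroup_fixedField (canonicalSubgroup U)]
    refine (IntermediateField.mem_fixingSubgroup_iff _ _).2 fun t ht => ?_
    have := hσ ⟨t, ht⟩
    rw [h] at this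
    exact this.symm
  have hc := IsQuadraticConj.of_ne_one (finrank_fixedField_canonicalSubgroup U hg₀) hσ1
  have hnorm : ∀ t : L, algebraMap k K (Algebra.norm k t) = t * g₀ t := fun t => by
    rw [IsScalarTower.algebraMap_apply k L K, hc.norm_eq, ← hσ]
    rfl
  constructor
  · rintro ⟨x, hx, hx'⟩
    let t : L := ⟨x, fun g => congrArg Units.val (hx g g.2)⟩
    refine ⟨t, (algebraMap k K).injective ?_⟩
    rw [hnorm]
    exact congrArg Units.val (hx' g₀ hg₀)
  · rintro ⟨t, ht⟩
    have ht0 : (t : K) ≠ 0 := fun h0 => a.ne_zero <| (algebraMap k K).injective <| by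
      rw [ht, hnorm, h0, zero_mul, map_zero]
    have hfix : ∀ g ∈ canonicalSubgroup U, g (t : K) = t := fun g hg => t.2 ⟨g, hg⟩
    refine ⟨Units.mk0 t ht0, fun g hg => Units.ext (hfix g hg), fun g hg => Units.ext ?_⟩
    change algebraMap k K a = t * g t
    -- Any two elements outside the canonical subgroup differ by one inside it, hence agree on `L`.
    have h1 : g (t : K) = g₀ t := by
      have := hfix _ (inv_mul_mem_canonicalSubgroup_of_notMem hg₀ hg)
      rw [AlgEquiv.mul_apply] at this
      conv_rhs => rw [← this, ← AlgEquiv.mul_apply, mul_inv_cancel, AlgEquiv.one_apply]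
    rw [ht, hnorm, h1]

end TwistedUnits

/-- Two surjective homomorphisms with the same kernel have isomorphic targets. -/
theorem MonoidHom.exists_mulEquiv_of_surjective {G H H' : Type*} [Group G] [Group H] [Group H']
    (f : G →* H) (g : G →* H') (hf : Function.Surjective f) (hg : Function.Surjective g)
    (h : f.ker = g.ker) : ∃ e : H ≃* H', ∀ x, e (f x) = g x := by
  let e := (QuotientGroup.quotientKerEquivOfSurjective f hf).symm.trans
    ((QuotientGroup.quotientMulEquivOfEq h).trans
      (QuotientGroup.quotientKerEquivOfSurjective g hg))
  refine ⟨e, fun x => ?_⟩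
  have : (QuotientGroup.quotientKerEquivOfSurjective f hf).symm (f x) = x := by
    rw [MulEquiv.symm_apply_eq]
    rfl
  simp only [e, MulEquiv.trans_apply, this]
  rfl

theorem theorem3p3 {k : Type u} {K : Type v} [Field k] [Field K] [Algebra k K]
    [FiniteDimensional k K] [IsGalois k K] (U : Representation ℤ Gal(K/k) ℤ) :
    ∃ Φ : FirstCohomology (twistedUnits U) ≃+
        Additive (relativeBrauerGroup k
          (IntermediateField.fixedField (canonicalSubgroup U) : IntermediateField k K)),
      -- every class is represented by one of the explicit cocycles
      (∀ x : FirstCohomology (twistedUnits U), ∃ a : kˣ, x = stepClass U a) ∧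
      -- two of them are cohomologous iff they differ by a norm
      (∀ a b : kˣ, stepClass U a = stepClass U b ↔
        ∃ t : (IntermediateField.fixedField (canonicalSubgroup U) : IntermediateField k K),
          (a : k) = b * Algebra.norm k t) ∧
      -- and the isomorphism sends them to the corresponding cyclic algebras
      (∀ (a : kˣ)
        (σ : Gal((IntermediateField.fixedField (canonicalSubgroup U) : IntermediateField k K)/k)),
        (∀ τ, τ ∈ Subgroup.zpowers σ) →
          ∃ A : CSA.{u, u} k, A.IsCyclicAlgebra σ a ∧
            ((Φ (stepClass U a)).toMul : BrauerGroup.{u, u} k) = Quotient.mk _ A) := by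
  have hgal : IsGalois k (IntermediateField.fixedField (canonicalSubgroup U)) :=
    IsGalois.of_fixedField_normal_subgroup _
  obtain ⟨β, hβ, hker, hcyc⟩ := exists_cyclicAlgebraHom (k := k)
    (L := (IntermediateField.fixedField (canonicalSubgroup U) : IntermediateField k K)) (by
      by_cases hI : ∃ g₀, g₀ ∉ canonicalSubgroup U
      · obtain ⟨g₀, hg₀⟩ := hI
        exact .inr (finrank_fixedField_canonicalSubgroup U hg₀)
      · push Not at hI
        exact .inl (finrank_fixedField_canonicalSubgroup_of_forall U hI))
  have hsurj : Function.Surjective (stepHom U) := fun z => by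
    obtain ⟨a, ha⟩ := stepClass_surjective U z.toAdd
    exact ⟨a, congrArg Multiplicative.ofAdd ha.symm⟩
  -- Both kernels are the group of units of `k` that are norms from `L`.
  obtain ⟨e, he⟩ := MonoidHom.exists_mulEquiv_of_surjective (stepHom U) β hsurj hβ (by
    ext a
    rw [MonoidHom.mem_ker, MonoidHom.mem_ker, hker, stepHom_eq_one_iff])
  refine ⟨MulEquiv.toAdditiveRight e, stepClass_surjective U, fun a b => ?_, fun a σ hσ => ?_⟩
  · have h1 : stepClass U a = stepClass U b ↔ stepHom U (b⁻¹ * a) = 1 := by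
      rw [map_mul, map_inv, inv_mul_eq_one, eq_comm]
      rfl
    rw [h1, stepHom_eq_one_iff]
    refine exists_congr fun t => ?_
    rw [Units.val_mul, Units.val_inv_eq_inv_val, inv_mul_eq_iff_eq_mul₀ b.ne_zero]
  · obtain ⟨A, hA, hAβ⟩ := hcyc a σ hσ
    exact ⟨A, hA, hAβ ▸ congrArg Subtype.val (he a)⟩
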